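/- A hypergraph $H$ on the vertex set $\{v_1,\dots,v_n\}$ has a multiset of edges $e_1,\dots,e_m\subseteq\{v_1,\dots,v_n\}$, and its discrepancy is $\mathrm{disc}(H)=\min_{\psi}\max_{1\le i\le m}\bigl|\sum_{v\in e_i}\psi(v)\bigr|$, where the minimum is over all colourings $\psi:\{v_1,\dots,v_n\}\to\{-1,1\}$. For $d\le m$, write $H\sim\mathcal H(n,m,d)$ if $H$ is generated as follows: independently for each vertex $v$, a set $I_v\subseteq\{1,\dots,m\}$ with $|I_v|=d$ is drawn uniformly at random, and $e_i=\{v: i\in I_v\}$ for $1\le i\le m$. Theorem. For every constant $c<1$ there is a constant $\kappa=\kappa(c)>0$ such that the following holds for all sequences $m=m(n)$ and $d=d(n)$ of positive integers that satisfy $dn/m\to\infty$ and $d\to\infty$ as $n\to\infty$, and $d/m\le c$ for all sufficiently large $n$. Let $H\sim\mathcal H(n,m,d)$. (1) If $m=O(n)$, then $$\mathbb P\Bigl[\mathrm{disc}(H)\ge \kappa\,\max\Bigl\{2^{-n/m}\sqrt{\tfrac{dn}{m}},\,1\Bigr\}\Bigr]\to 1\qquad(n\to\infty).$$ (2) If $n=o(m)$,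 then $$\mathbb P\Bigl[\mathrm{disc}(H)\ge \kappa\,\sqrt{\tfrac{dn}{m}\log\gamma}\Bigr]\to 1\qquad(n\to\infty),\qquad\text{where }\gamma=\min\{m/n,\;dn/m\}.$$ -/

import Mathlib

open Filter Topology Asymptotics MeasureTheory ProbabilityTheory

namespace RandomHypergraph

/-- A hypergraph with vertex set `Fin n` and a multiset of `m` edges `e 0, …, e (m - 1)`, each of
which is a set of vertices (repeated edges are allowed). -/
abbrev Hypergraph (n m : ℕ) : Type := Fin m → Finset (Fin n)

/-- A colouring assigns a value in `{-1, 1} = ℤˣ` to every vertex. -/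
abbrev Colouring (n : ℕ) : Type := Fin n → ℤˣ

/-- The value `ψ(e) = ∑_{v ∈ e} ψ(v)` of a colouring on a set of vertices. -/
def Colouring.value {n : ℕ} (ψ : Colouring n) (e : Finset (Fin n)) : ℤ :=
  ∑ v ∈ e, (ψ v : ℤ)

/-- The discrepancy of a colouring: the maximum of `|ψ(e)|` over the edges `e`. -/
def Hypergraph.colouringDisc {n m : ℕ} (H : Hypergraph n m) (ψ : Colouring n) : ℕ :=
  Finset.univ.sup fun i : Fin m => (ψ.value (H i)).natAbs

/-- The discrepancy of a hypergraph: the minimum of the discrepancy over all colourings. -/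
def Hypergraph.disc {n m : ℕ} (H : Hypergraph n m) : ℕ :=
  Finset.univ.inf' Finset.univ_nonempty fun ψ : Colouring n => H.colouringDisc ψ

/-- The hypergraph in which the vertex `u` belongs to exactly the edges with index in `I u`. -/
def ofIncidence {n m : ℕ} (I : Fin n → Finset (Fin m)) : Hypergraph n m :=
  fun i => Finset.univ.filter fun u => i ∈ I u

/-- The edge-dependent random hypergraph model with `n` vertices, `m` edges and degree `d`: the
sets `I u`, for `u : Fin n`, are drawn independently and uniformly at random among the subsets of
`Fin m` of size `d`, and the `i`-th edge is `{u | i ∈ I u}`. -/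
noncomputable def edgeDependentModel (n m d : ℕ) : Measure (Hypergraph n m) :=
  (Measure.pi fun _ : Fin n => uniformOn {s : Finset (Fin m) | s.card = d}).map ofIncidence

end RandomHypergraph

/-! The proof is a first moment bound over the `2 ^ n` colourings. For a fixed colouring `ψ`, reveal
the edges one at a time. Given that `r` edges are left and vertex `v` still has to lie in `D v` of
them, the next edge contains each `v` independently with probability `D v / r`. So `ψ(e)` is a
signed sum of independent Bernoulli variables, and a bound `q` on the conditional probability of
`|ψ(e)| < Δ` multiplies over the exposed edges (`card_exposedFamilies_le`).

Such a `q` needs variance of order `dn/m`. By Chebyshev for random `d`-sets and an exponential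
moment over the vertices, more than half of the vertices keep `D v` close to `r d / m` at all times,
except with tiny probability, as long as more than `r₀ = o(m)` edges are left. Hence
(`card_disc_lt_le`) the probability of discrepancy below `Δ` is at most `2 ^ n * q ^ (m - r₀)` plus
an error.

In the dense regime Fourier inversion (`bernoulliExp_eq_le`) bounds point probabilities by the
inverse standard deviation, which gives `q` equal to a small constant times `2 ^ (-n/m)`. The bound
`1` inside the maximum is a parity matter: in a hypergraph of discrepancy `0` every edge has even
size, so one incidence set is determined by the others. In the sparse regime
`bernoulliExp_moderate_deviation` makes an edge exceed the threshold with probability at least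
`√(n/m)`; about `m` such chances beat `2 ^ n`. -/

namespace RandomHypergraph

/-! ### Moments and lower tail bounds for signed Bernoulli sums. -/

section BernoulliSubset

variable {V : Type*} [DecidableEq V]

/-- The expectation of `f e` when `e ⊆ T` is a random set containing each `v ∈ T` independently
with probability `p v`. -/
def bernoulliExp (p : V → ℝ) (T : Finset V) (f : Finset V → ℝ) : ℝ :=
  ∑ e ∈ T.powerset, (∏ v ∈ T, if v ∈ e then p v else 1 - p v) * f e

variable {p : V → ℝ} {T : Finset V}

theorem bernoulliExp_empty (f : Finset V → ℝ) : bernoulliExp p ∅ f = f ∅ := by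
  simp [bernoulliExp]

theorem bernoulliExp_insert {a : V} (ha : a ∉ T) (f : Finset V → ℝ) :
    bernoulliExp p (insert a T) f =
      (1 - p a) * bernoulliExp p T f + p a * bernoulliExp p T (fun e => f (insert a e)) := by
  unfold bernoulliExp
  rw [Finset.sum_powerset_insert ha, Finset.mul_sum, Finset.mul_sum]
  congr 1
  · refine Finset.sum_congr rfl fun e he => ?_
    have hae : a ∉ e := fun h => ha (Finset.mem_powerset.1 he h)
    rw [Finset.prod_insert ha, if_neg hae, mul_assoc]
  · refine Finset.sum_congr rfl fun e he => ?_
    rw [Finset.prod_insert ha, if_pos (Finset.mem_insert_self a e), mul_assoc]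
    congr 2
    refine Finset.prod_congr rfl fun v hv => ?_
    have hva : v ≠ a := fun h => ha (h ▸ hv)
    simp [Finset.mem_insert, hva]

theorem bernoulliExp_congr {f g : Finset V → ℝ} (h : ∀ e ⊆ T, f e = g e) :
    bernoulliExp p T f = bernoulliExp p T g :=
  Finset.sum_congr rfl fun e he => by rw [h e (Finset.mem_powerset.1 he)]

theorem bernoulliExp_add (f g : Finset V → ℝ) :
    bernoulliExp p T (fun e => f e + g e) = bernoulliExp p T f + bernoulliExp p T g := by
  simp only [bernoulliExp, mul_add, Finset.sum_add_distrib]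

theorem bernoulliExp_mul_left (a : ℝ) (f : Finset V → ℝ) :
    bernoulliExp p T (fun e => a * f e) = a * bernoulliExp p T f := by
  simp only [bernoulliExp, Finset.mul_sum]
  exact Finset.sum_congr rfl fun e _ => by ring

theorem bernoulliExp_const (a : ℝ) : bernoulliExp p T (fun _ => a) = a := by
  induction T using Finset.induction_on with
  | empty => exact bernoulliExp_empty _
  | insert v T hv ih => rw [bernoulliExp_insert hv, ih]; ring

theorem bernoulliExp_mono (hp0 : ∀ v, 0 ≤ p v) (hp1 : ∀ v, p v ≤ 1) {f g : Finset V → ℝ}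
    (h : ∀ e ⊆ T, f e ≤ g e) : bernoulliExp p T f ≤ bernoulliExp p T g := by
  refine Finset.sum_le_sum fun e he => ?_
  refine mul_le_mul_of_nonneg_left (h e (Finset.mem_powerset.1 he)) ?_
  refine Finset.prod_nonneg fun v _ => ?_
  split_ifs
  · exact hp0 v
  · linarith [hp1 v]

theorem bernoulliExp_union {T₁ T₂ : Finset V} (h : Disjoint T₁ T₂) (f : Finset V → ℝ) :
    bernoulliExp p (T₁ ∪ T₂) f =
      bernoulliExp p T₁ (fun a => bernoulliExp p T₂ (fun b => f (a ∪ b))) := by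
  induction T₁ using Finset.induction_on generalizing f with
  | empty => simp [bernoulliExp_empty]
  | insert v T hv ih =>
    have hd := Finset.disjoint_insert_left.1 h
    have hv' : v ∉ T ∪ T₂ := by simp [hv, hd.1]
    rw [Finset.insert_union, bernoulliExp_insert hv', bernoulliExp_insert hv, ih hd.2, ih hd.2]
    simp only [Finset.insert_union]

/-- The variance of the size of a random set that contains each `v ∈ T` independently with
probability `p v`. -/
def bernoulliVar (p : V → ℝ) (T : Finset V) : ℝ := ∑ v ∈ T, p v * (1 - p v)

/-- The deviation of the signed size of `e ∩ T` from its mean. -/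
def deviation (p ψ : V → ℝ) (T e : Finset V) : ℝ :=
  ∑ v ∈ T, ψ v * ((if v ∈ e then 1 else 0) - p v)

variable {ψ : V → ℝ}

theorem bernoulliExp_deviation_insert {a : V} (ha : a ∉ T) (g : ℝ → ℝ) :
    bernoulliExp p (insert a T) (fun e => g (deviation p ψ (insert a T) e)) =
      (1 - p a) * bernoulliExp p T (fun e => g (deviation p ψ T e - ψ a * p a)) +
        p a * bernoulliExp p T (fun e => g (deviation p ψ T e + ψ a * (1 - p a))) := by
  rw [bernoulliExp_insert ha]
  congr 2
  · refine bernoulliExp_congr fun e he => ?_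
    have hae : a ∉ e := fun h => ha (he h)
    rw [deviation, Finset.sum_insert ha, if_neg hae, deviation]
    congr 1
    ring
  · refine bernoulliExp_congr fun e he => ?_
    rw [deviation, Finset.sum_insert ha, if_pos (Finset.mem_insert_self a e), deviation, add_comm]
    congr 2
    refine Finset.sum_congr rfl fun v hv => ?_
    have hva : v ≠ a := fun h => ha (h ▸ hv)
    simp [Finset.mem_insert, hva]

theorem bernoulliExp_deviation : bernoulliExp p T (deviation p ψ T) = 0 := by
  induction T using Finset.induction_on with
  | empty => simp [bernoulliExp_empty, deviation]
  | insert a T ha ih =>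
    have h := bernoulliExp_deviation_insert (p := p) (ψ := ψ) ha (fun y => y)
    simp only [sub_eq_add_neg, bernoulliExp_add, bernoulliExp_const] at h
    change bernoulliExp p (insert a T) (fun e => deviation p ψ (insert a T) e) = 0
    change bernoulliExp p T (fun e => deviation p ψ T e) = 0 at ih
    rw [h, ih]
    ring

theorem bernoulliExp_deviation_sq (hψ : ∀ v, ψ v ^ 2 = 1) :
    bernoulliExp p T (fun e => deviation p ψ T e ^ 2) = bernoulliVar p T := by
  induction T using Finset.induction_on with
  | empty => simp [bernoulliExp_empty, deviation, bernoulliVar]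
  | insert a T ha ih =>
    have h0 : bernoulliExp p T (fun e => deviation p ψ T e) = 0 := bernoulliExp_deviation
    have h (c : ℝ) : bernoulliExp p T (fun e => (deviation p ψ T e + c) ^ 2) =
        bernoulliVar p T + c ^ 2 := by
      have : ∀ e, (deviation p ψ T e + c) ^ 2 =
          deviation p ψ T e ^ 2 + (2 * c * deviation p ψ T e + c ^ 2) := fun e => by ring
      simp only [this, bernoulliExp_add, bernoulliExp_mul_left, bernoulliExp_const, ih, h0]
      ring
    rw [bernoulliExp_deviation_insert ha (fun y => y ^ 2)]
    simp only [sub_eq_add_neg (deviation _ _ _ _), h]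
    rw [bernoulliVar, bernoulliVar, Finset.sum_insert ha]
    linear_combination (p a * (1 - p a)) * hψ a

/-- A new summand has mean zero, so the third moment `m₃` cancels. With `z = q * (1 - q)` the fourth
moment grows by at most `6 * z * σ + z`, which the growth of `3 * σ ^ 2 + σ` covers. -/
theorem bernoulliExp_deviation_pow_four_le (hp0 : ∀ v, 0 ≤ p v) (hp1 : ∀ v, p v ≤ 1)
    (hψ : ∀ v, ψ v ^ 2 = 1) :
    bernoulliExp p T (fun e => deviation p ψ T e ^ 4) ≤
      3 * bernoulliVar p T ^ 2 + bernoulliVar p T := by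
  induction T using Finset.induction_on with
  | empty => simp [bernoulliExp_empty, deviation, bernoulliVar]
  | insert a T ha ih =>
    have h0 : bernoulliExp p T (fun e => deviation p ψ T e) = 0 := bernoulliExp_deviation
    have h2 := bernoulliExp_deviation_sq (p := p) (T := T) hψ
    set m₃ := bernoulliExp p T (fun e => deviation p ψ T e ^ 3)
    set m₄ := bernoulliExp p T (fun e => deviation p ψ T e ^ 4)
    have h (c : ℝ) : bernoulliExp p T (fun e => (deviation p ψ T e + c) ^ 4) =
        m₄ + 4 * c * m₃ + 6 * c ^ 2 * bernoulliVar p T + c ^ 4 := by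
      have : ∀ e, (deviation p ψ T e + c) ^ 4 =
          deviation p ψ T e ^ 4 + (4 * c * deviation p ψ T e ^ 3 +
            (6 * c ^ 2 * deviation p ψ T e ^ 2 + (4 * c ^ 3 * deviation p ψ T e + c ^ 4))) :=
        fun e => by ring
      simp only [this, bernoulliExp_add, bernoulliExp_mul_left, bernoulliExp_const, h2, h0]
      ring
    rw [bernoulliExp_deviation_insert ha (fun y => y ^ 4)]
    simp only [sub_eq_add_neg (deviation _ _ _ _), h]
    have hv : bernoulliVar p (insert a T) = p a * (1 - p a) + bernoulliVar p T := by
      rw [bernoulliVar, Finset.sum_insert ha, bernoulliVar]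
    rw [hv]
    have e4 : ψ a ^ 4 = 1 := by
      calc ψ a ^ 4 = (ψ a ^ 2) ^ 2 := by ring
        _ = 1 := by rw [hψ a]; norm_num
    have q0 := hp0 a
    have q1 := hp1 a
    set q := p a
    set σ := bernoulliVar p T
    have hz : 0 ≤ q * (1 - q) := mul_nonneg q0 (by linarith)
    have key : (1 - q) * (m₄ + 4 * -(ψ a * q) * m₃ + 6 * (-(ψ a * q)) ^ 2 * σ + (-(ψ a * q)) ^ 4) +
        q * (m₄ + 4 * (ψ a * (1 - q)) * m₃ + 6 * (ψ a * (1 - q)) ^ 2 * σ + (ψ a * (1 - q)) ^ 4)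
        = m₄ + 6 * (q * (1 - q)) * σ + q * (1 - q) * (q ^ 3 + (1 - q) ^ 3) := by
      linear_combination (6 * (q * (1 - q)) * σ) * hψ a +
        (q * (1 - q) * (q ^ 3 + (1 - q) ^ 3)) * e4
    rw [key]
    have : q ^ 3 + (1 - q) ^ 3 ≤ 1 := by nlinarith
    nlinarith [mul_le_mul_of_nonneg_left this hz, sq_nonneg (q * (1 - q))]

/-- A mean-zero signed Bernoulli sum exceeds a fixed fraction of its standard deviation with
probability bounded below. -/
theorem bernoulliExp_deviation_tail (hp0 : ∀ v, 0 ≤ p v) (hp1 : ∀ v, p v ≤ 1)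
    (hψ : ∀ v, ψ v ^ 2 = 1) {s : ℝ} (hs : 1 ≤ s) (hsT : s ≤ bernoulliVar p T) :
    1 / 32 ≤ bernoulliExp p T (fun e => if √s / 10 ≤ deviation p ψ T e then 1 else 0) := by
  set σ := bernoulliVar p T with hσ
  have hσ1 : 1 ≤ σ := hs.trans hsT
  set r := √σ with hr
  have hr2 : r ^ 2 = σ := Real.sq_sqrt (by linarith)
  have hr0 : 0 < r := Real.sqrt_pos.2 (by linarith)
  -- The polynomial `-1/2 + 9/2 y + 5 y² - y⁴` in the normalised deviation `y` is at most `16`, and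
  -- at most `0` for `y ≤ 1/10`. Its mean is at least `-1/2 + 5 - 4 = 1/2`, whence `1/32`. The
  -- linear term has mean zero and makes the bound one-sided.
  have hpt : ∀ e ⊆ T, -1 / 2 + ((9 / 2 / r) * deviation p ψ T e + ((5 / r ^ 2) *
      deviation p ψ T e ^ 2 + (-(1 / r ^ 4)) * deviation p ψ T e ^ 4)) ≤
      16 * (if √s / 10 ≤ deviation p ψ T e then 1 else 0) := by
    intro e _
    obtain ⟨y, hy⟩ : ∃ y, deviation p ψ T e = y * r := ⟨deviation p ψ T e / r, by field_simp⟩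
    rw [hy]
    have e1 : -1 / 2 + ((9 / 2 / r) * (y * r) + ((5 / r ^ 2) * (y * r) ^ 2 +
        (-(1 / r ^ 4)) * (y * r) ^ 4)) = -1 / 2 + 9 / 2 * y + 5 * y ^ 2 - y ^ 4 := by
      field_simp
      ring
    rw [e1]
    split_ifs with h
    · nlinarith [sq_nonneg (y ^ 2 - 3), sq_nonneg (y - 2), sq_nonneg (y^2 - y), sq_nonneg y]
    · have hy1 : y ≤ 1 / 10 := by
        by_contra hcon
        push Not at hcon h
        have : √s ≤ r := Real.sqrt_le_sqrt hsT
        nlinarith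
      rcases le_or_gt 0 y with h0 | h0
      · nlinarith [sq_nonneg (y ^ 2)]
      · have : 0 ≤ (-y) * (9 / 2 - 5 * (-y) + (-y) ^ 3) := by
          refine mul_nonneg (by linarith) ?_
          nlinarith [mul_nonneg (by linarith : 0 ≤ -y) (sq_nonneg (-y - 13 / 10)),
            sq_nonneg (-y - 13 / 10)]
        nlinarith
  have h := bernoulliExp_mono hp0 hp1 hpt
  rw [bernoulliExp_add, bernoulliExp_add, bernoulliExp_add, bernoulliExp_mul_left,
    bernoulliExp_mul_left, bernoulliExp_mul_left, bernoulliExp_mul_left, bernoulliExp_const,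
    bernoulliExp_deviation_sq hψ] at h
  have h0 : bernoulliExp p T (fun e => deviation p ψ T e) = 0 := bernoulliExp_deviation
  have h4 := bernoulliExp_deviation_pow_four_le (T := T) hp0 hp1 hψ
  rw [h0, ← hσ] at h
  rw [← hσ] at h4
  have hr4 : r ^ 4 = σ ^ 2 := by rw [← hr2]; ring
  rw [hr2, hr4] at h
  have e5 : 5 / σ * σ = 5 := by field_simp
  have : 1 / σ ^ 2 * bernoulliExp p T (fun e => deviation p ψ T e ^ 4) ≤ 4 := by
    rw [one_div, inv_mul_le_iff₀ (by positivity)]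
    nlinarith
  linarith

theorem deviation_union {T₁ T₂ a b : Finset V} (h : Disjoint T₁ T₂) (ha : a ⊆ T₁) (hb : b ⊆ T₂) :
    deviation p ψ (T₁ ∪ T₂) (a ∪ b) = deviation p ψ T₁ a + deviation p ψ T₂ b := by
  rw [deviation, Finset.sum_union h]
  congr 1
  · refine Finset.sum_congr rfl fun v hv => ?_
    have : v ∉ b := fun hvb => Finset.disjoint_left.1 h hv (hb hvb)
    simp [this]
  · refine Finset.sum_congr rfl fun v hv => ?_
    have : v ∉ a := fun hva => Finset.disjoint_left.1 h (ha hva) hv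
    simp [this]

/-- Adding elements one by one overshoots `s` by at most one summand, and each summand is at most
`1`. -/
theorem exists_subset_bernoulliVar {s : ℝ} (hp0 : ∀ v, 0 ≤ p v) (hp1 : ∀ v, p v ≤ 1) (hs : 0 ≤ s)
    (h : s ≤ bernoulliVar p T) : ∃ U ⊆ T, s ≤ bernoulliVar p U ∧ bernoulliVar p U ≤ s + 1 := by
  induction T using Finset.induction_on with
  | empty => exact ⟨∅, le_rfl, h, by simp [bernoulliVar]; linarith⟩
  | insert a T ha ih =>
    by_cases hT : s ≤ bernoulliVar p T
    · obtain ⟨U, hU, h1, h2⟩ := ih hT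
      exact ⟨U, hU.trans (Finset.subset_insert _ _), h1, h2⟩
    · refine ⟨_, le_rfl, h, ?_⟩
      rw [bernoulliVar, Finset.sum_insert ha]
      rw [bernoulliVar] at hT
      nlinarith [hp0 a, hp1 a]

/-- A lower bound for moderate deviations of a signed Bernoulli sum, obtained by splitting the
index set into `K` parts that all deviate by their standard deviation. -/
theorem bernoulliExp_moderate_deviation (hp0 : ∀ v, 0 ≤ p v) (hp1 : ∀ v, p v ≤ 1)
    (hψ : ∀ v, ψ v ^ 2 = 1) {s : ℝ} (hs : 1 ≤ s) (K : ℕ)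
    (hT : (K + 1) * (s + 1) ≤ bernoulliVar p T) :
    (1 / 32) ^ (K + 1) ≤ bernoulliExp p T
      (fun e => if (K + 1) * (√s / 10) ≤ deviation p ψ T e then 1 else 0) := by
  induction K generalizing T with
  | zero =>
    have := bernoulliExp_deviation_tail (T := T) hp0 hp1 hψ hs (by norm_num at hT; linarith)
    simpa using this
  | succ K ih =>
    push_cast at hT ⊢
    have hK : (0 : ℝ) ≤ K := K.cast_nonneg
    -- Cut off one block of variance between `s` and `s + 1`. Deviations on disjoint blocks are
    -- independent, and their one-sided bounds add.
    obtain ⟨U, hUT, hU1, hU2⟩ := exists_subset_bernoulliVar (T := T) (s := s) hp0 hp1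
      (by linarith) (by nlinarith)
    have hd : Disjoint U (T \ U) := Finset.disjoint_sdiff
    have hun : U ∪ (T \ U) = T := Finset.union_sdiff_of_subset hUT
    have hvar : bernoulliVar p U + bernoulliVar p (T \ U) = bernoulliVar p T := by
      conv_rhs => rw [← hun]
      rw [bernoulliVar, bernoulliVar, bernoulliVar, Finset.sum_union hd]
    have h1 := bernoulliExp_deviation_tail (ψ := ψ) hp0 hp1 hψ hs hU1
    have h2 := ih (T := T \ U) (by nlinarith)
    set A := fun e => (if √s / 10 ≤ deviation p ψ U e then (1 : ℝ) else 0) with hA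
    set B := fun e => (if (K + 1) * (√s / 10) ≤ deviation p ψ (T \ U) e then (1 : ℝ) else 0)
      with hB
    calc (1 / 32 : ℝ) ^ (K + 1 + 1) = 1 / 32 * (1 / 32) ^ (K + 1) := by ring
      _ ≤ bernoulliExp p U A * bernoulliExp p (T \ U) B := by gcongr
      _ = bernoulliExp p U (fun a => bernoulliExp p (T \ U) (fun b => A a * B b)) := by
        simp only [bernoulliExp_mul_left]
        rw [mul_comm, ← bernoulliExp_mul_left]
        simp only [mul_comm]
      _ ≤ bernoulliExp p U (fun a => bernoulliExp p (T \ U) (fun b =>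
          if (K + 1 + 1) * (√s / 10) ≤ deviation p ψ T (a ∪ b) then 1 else 0)) := by
        refine bernoulliExp_mono hp0 hp1 fun a ha => bernoulliExp_mono hp0 hp1 fun b hb => ?_
        have hdu := deviation_union (p := p) (ψ := ψ) hd ha hb
        rw [hun] at hdu
        rw [hdu]
        simp only [hA, hB]
        split_ifs with x1 x2 x3 <;> norm_num
        exact x3 (by linarith)
      _ = _ := by
        rw [← bernoulliExp_union hd
          (fun e => if (K + 1 + 1) * (√s / 10) ≤ deviation p ψ T e then 1 else 0), hun]

end BernoulliSubset

/-! ### Point probabilities by Fourier inversion. -/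

section Anticoncentration

variable {V : Type*} [DecidableEq V] {p : V → ℝ} {T : Finset V} {ψ : V → ℤ}

/-- This is the squared modulus of the characteristic function, in real form. It factors by
independence, and neither the signs nor the shift `x` affect the modulus. -/
theorem bernoulliExp_cos_sq_add_sin_sq (hψ : ∀ v, ψ v = 1 ∨ ψ v = -1) (x : ℤ) (θ : ℝ) :
    bernoulliExp p T (fun e => Real.cos (((∑ v ∈ e, ψ v - x : ℤ) : ℝ) * θ)) ^ 2 +
      bernoulliExp p T (fun e => Real.sin (((∑ v ∈ e, ψ v - x : ℤ) : ℝ) * θ)) ^ 2 =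
      ∏ v ∈ T, (1 - 2 * (p v * (1 - p v)) * (1 - Real.cos θ)) := by
  induction T using Finset.induction_on with
  | empty => simp [bernoulliExp_empty]
  | insert a T ha ih =>
    have hc : bernoulliExp p T (fun e => Real.cos (((∑ v ∈ insert a e, ψ v - x : ℤ) : ℝ) * θ)) =
        bernoulliExp p T (fun e => Real.cos (ψ a * θ) *
          Real.cos (((∑ v ∈ e, ψ v - x : ℤ) : ℝ) * θ) + -Real.sin (ψ a * θ) *
          Real.sin (((∑ v ∈ e, ψ v - x : ℤ) : ℝ) * θ)) := by
      refine bernoulliExp_congr fun e he => ?_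
      rw [Finset.sum_insert fun h => ha (he h), neg_mul, ← sub_eq_add_neg, ← Real.cos_add]
      push_cast
      ring_nf
    have hs : bernoulliExp p T (fun e => Real.sin (((∑ v ∈ insert a e, ψ v - x : ℤ) : ℝ) * θ)) =
        bernoulliExp p T (fun e => Real.sin (ψ a * θ) *
          Real.cos (((∑ v ∈ e, ψ v - x : ℤ) : ℝ) * θ) + Real.cos (ψ a * θ) *
          Real.sin (((∑ v ∈ e, ψ v - x : ℤ) : ℝ) * θ)) := by
      refine bernoulliExp_congr fun e he => ?_
      rw [Finset.sum_insert fun h => ha (he h), ← Real.sin_add]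
      push_cast
      ring_nf
    rw [bernoulliExp_insert ha, bernoulliExp_insert ha, hc, hs, bernoulliExp_add,
      bernoulliExp_add, bernoulliExp_mul_left, bernoulliExp_mul_left, bernoulliExp_mul_left,
      bernoulliExp_mul_left, Finset.prod_insert ha, ← ih]
    have h1 : Real.cos (ψ a * θ) = Real.cos θ := by
      rcases hψ a with h | h <;> simp [h]
    have h2 : Real.sin (ψ a * θ) ^ 2 = 1 - Real.cos θ ^ 2 := by
      rw [← h1, Real.sin_sq]
    rw [h1]
    set A := bernoulliExp p T (fun e => Real.cos (((∑ v ∈ e, ψ v - x : ℤ) : ℝ) * θ))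
    set B := bernoulliExp p T (fun e => Real.sin (((∑ v ∈ e, ψ v - x : ℤ) : ℝ) * θ))
    linear_combination (p a ^ 2 * (A ^ 2 + B ^ 2)) * h2

theorem intervalIntegral_cos_int_mul (k : ℤ) :
    ∫ θ in (-Real.pi)..Real.pi, Real.cos (k * θ) = if k = 0 then 2 * Real.pi else 0 := by
  split_ifs with h
  · simp [h]
    ring
  · have hk : (k : ℝ) ≠ 0 := by exact_mod_cast h
    rw [intervalIntegral.integral_comp_mul_left _ hk, integral_cos]
    simp [Real.sin_int_mul_pi]

/-- Gaussian decay of the characteristic function on `[-π, π]`, from `cos θ ≤ 1 - 2 θ² / π²` and `1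
- u ≤ exp (-u)` in each factor. -/
theorem bernoulliExp_cos_le (hp0 : ∀ v, 0 ≤ p v) (hp1 : ∀ v, p v ≤ 1)
    (hψ : ∀ v, ψ v = 1 ∨ ψ v = -1) (x : ℤ) {θ : ℝ} (hθ : |θ| ≤ Real.pi) :
    bernoulliExp p T (fun e => Real.cos (((∑ v ∈ e, ψ v - x : ℤ) : ℝ) * θ)) ≤
      Real.exp (-(2 * bernoulliVar p T / Real.pi ^ 2) * θ ^ 2) := by
  have h := bernoulliExp_cos_sq_add_sin_sq (p := p) (T := T) hψ x θ
  refine le_of_sq_le_sq ?_ (Real.exp_pos _).le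
  have h2 : ∏ v ∈ T, (1 - 2 * (p v * (1 - p v)) * (1 - Real.cos θ)) ≤
      Real.exp (-(2 * bernoulliVar p T / Real.pi ^ 2) * θ ^ 2) ^ 2 := by
    rw [← Real.exp_nat_mul]
    have : ((2 : ℕ) : ℝ) * (-(2 * bernoulliVar p T / Real.pi ^ 2) * θ ^ 2) =
        ∑ v ∈ T, -(2 * (p v * (1 - p v)) * (2 / Real.pi ^ 2 * θ ^ 2)) := by
      rw [bernoulliVar, Finset.sum_neg_distrib, ← Finset.sum_mul, ← Finset.mul_sum]
      push_cast
      ring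
    rw [this, Real.exp_sum]
    refine Finset.prod_le_prod (fun v _ => ?_) fun v _ => ?_
    · have := mul_nonneg (hp0 v) (sub_nonneg.2 (hp1 v))
      nlinarith [Real.cos_le_one θ, Real.neg_one_le_cos θ, sq_nonneg (p v - 1 / 2)]
    · refine (Real.one_sub_le_exp_neg _).trans (Real.exp_le_exp.2 (neg_le_neg ?_))
      have h3 := Real.cos_le_one_sub_mul_cos_sq hθ
      have := mul_nonneg (hp0 v) (sub_nonneg.2 (hp1 v))
      exact mul_le_mul_of_nonneg_left (by linarith) (by linarith)
  nlinarith [sq_nonneg (bernoulliExp p T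
    (fun e => Real.sin (((∑ v ∈ e, ψ v - x : ℤ) : ℝ) * θ)))]

/-- Point probabilities of a signed Bernoulli sum are at most the inverse of its standard
deviation. -/
theorem bernoulliExp_eq_le (hp0 : ∀ v, 0 ≤ p v) (hp1 : ∀ v, p v ≤ 1)
    (hψ : ∀ v, ψ v = 1 ∨ ψ v = -1) (x : ℤ) (hT : 0 < bernoulliVar p T) :
    bernoulliExp p T (fun e => if ∑ v ∈ e, ψ v = x then 1 else 0) ≤ 1 / √(bernoulliVar p T) := by
  set σ := bernoulliVar p T with hσ
  have hpi := Real.pi_pos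
  have hb : 0 < 2 * σ / Real.pi ^ 2 := by positivity
  have h1 : ∫ θ in (-Real.pi)..Real.pi,
      bernoulliExp p T (fun e => Real.cos (((∑ v ∈ e, ψ v - x : ℤ) : ℝ) * θ)) =
      2 * Real.pi * bernoulliExp p T (fun e => if ∑ v ∈ e, ψ v = x then 1 else 0) := by
    rw [← bernoulliExp_mul_left]
    unfold bernoulliExp
    rw [intervalIntegral.integral_finsetSum]
    · refine Finset.sum_congr rfl fun e _ => ?_
      rw [intervalIntegral.integral_const_mul, intervalIntegral_cos_int_mul]
      congr 1
      simp [sub_eq_zero]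
    · intro e _
      exact Continuous.intervalIntegrable (by fun_prop) _ _
  have h2 : ∫ θ in (-Real.pi)..Real.pi,
      bernoulliExp p T (fun e => Real.cos (((∑ v ∈ e, ψ v - x : ℤ) : ℝ) * θ)) ≤
      ∫ θ in (-Real.pi)..Real.pi, Real.exp (-(2 * σ / Real.pi ^ 2) * θ ^ 2) := by
    refine intervalIntegral.integral_mono_on (by linarith) ?_ ?_ ?_
    · unfold bernoulliExp
      exact Continuous.intervalIntegrable (by fun_prop) _ _
    · exact Continuous.intervalIntegrable (by fun_prop) _ _
    · intro θ hθ
      exact bernoulliExp_cos_le hp0 hp1 hψ x (abs_le.2 hθ)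
  have h3 : ∫ θ in (-Real.pi)..Real.pi, Real.exp (-(2 * σ / Real.pi ^ 2) * θ ^ 2) ≤
      √(Real.pi / (2 * σ / Real.pi ^ 2)) := by
    rw [← integral_gaussian, intervalIntegral.integral_of_le (by linarith)]
    exact setIntegral_le_integral (integrable_exp_neg_mul_sq hb)
      (Eventually.of_forall fun θ => (Real.exp_pos _).le)
  -- After squaring this amounts to `π ≤ 8`.
  have h4 : √(Real.pi / (2 * σ / Real.pi ^ 2)) ≤ 2 * Real.pi * (1 / √σ) := by
    rw [Real.sqrt_le_left (by positivity), mul_pow, div_pow, Real.sq_sqrt hT.le]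
    rw [div_div_eq_mul_div, one_pow, mul_one_div, div_le_div_iff₀ (by positivity) hT]
    have : Real.pi ≤ 8 := by linarith [Real.pi_le_four]
    have h5 : 0 ≤ Real.pi ^ 2 * σ := by positivity
    nlinarith [mul_le_mul_of_nonneg_left this h5]
  have h5 := h1 ▸ h2.trans (h3.trans h4)
  exact le_of_mul_le_mul_left h5 (by positivity)

end Anticoncentration

/-! ### Revealing the edges one at a time. -/

section Exposure

variable {V : Type*} [Fintype V] [DecidableEq V]

/-- The number of edges with index at least `j` that contain `v`. -/
def tailDegree {k : ℕ} (e : Fin k → Finset V) (j : ℕ) (v : V) : ℕ :=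
  (Finset.univ.filter fun i : Fin k => j ≤ i ∧ v ∈ e i).card

omit [Fintype V] in
theorem tailDegree_succ {k : ℕ} (e : Fin (k + 1) → Finset V) (j : ℕ) :
    tailDegree e (j + 1) = tailDegree (Fin.tail e) j := by
  funext v
  rw [tailDegree, Fin.card_filter_univ_succ]
  simp only [Fin.val_zero, nonpos_iff_eq_zero, Nat.add_eq_zero_iff, one_ne_zero, and_false,
    false_and, if_false, Fin.val_succ, add_le_add_iff_right]
  rfl

omit [Fintype V] in
theorem tailDegree_zero {k : ℕ} (e : Fin (k + 1) → Finset V) (v : V) :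
    tailDegree e 0 v = (if v ∈ e 0 then 1 else 0) + tailDegree (Fin.tail e) 0 v := by
  rw [tailDegree, Fin.card_filter_univ_succ]
  simp only [tailDegree, Fin.tail, Fin.val_zero, le_refl, true_and, zero_le]
  split_ifs <;> omega

omit [Fintype V] in
theorem tailDegree_le {k : ℕ} (e : Fin k → Finset V) (j : ℕ) (v : V) : tailDegree e j v ≤ k :=
  (Finset.card_le_univ _).trans (by simp)

open Classical in
/-- The sequences of `k` edges with degree sequence `D` that, at each of the first `k - r₀` steps,
have a next edge in `S` and remaining degrees in `G r`, where `r` is the number of edges left. -/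
noncomputable def exposedFamilies (S : Finset (Finset V)) (G : ℕ → Set (V → ℕ)) (r₀ k : ℕ)
    (D : V → ℕ) : Finset (Fin k → Finset V) :=
  Finset.univ.filter fun e => tailDegree e 0 = D ∧
    ∀ j : Fin k, j + r₀ < k → e j ∈ S ∧ tailDegree e j ∈ G (k - j)

theorem choose_mul_div {k d : ℕ} :
    ((k + 1).choose (d + 1) : ℝ) * ((d + 1 : ℕ) / (k + 1 : ℕ)) = k.choose d := by
  have h : ((k + 1) * k.choose d : ℝ) = (k + 1).choose (d + 1) * (d + 1) := by
    exact_mod_cast Nat.add_one_mul_choose_eq k d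
  push_cast
  field_simp
  linarith

theorem choose_mul_one_sub_div {k d : ℕ} (hd : d ≤ k + 1) :
    ((k + 1).choose d : ℝ) * (1 - d / (k + 1 : ℕ)) = k.choose d := by
  have h : (k.choose d * (k + 1) : ℝ) = (k + 1).choose d * ((k + 1 : ℕ) - d) := by
    rw [← Nat.cast_sub hd]
    exact_mod_cast Nat.choose_mul_succ_eq k d
  have : ((k + 1 : ℕ) : ℝ) ≠ 0 := by positivity
  field_simp
  rw [← h]
  push_cast
  ring

open Classical in
/-- If, conditionally on the past, each exposed edge lies in `S` with probability at most `q`, then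
a fraction of at most `q ^ (k - r₀)` of the families with given degrees is exposed in `S`. -/
theorem card_exposedFamilies_le (S : Finset (Finset V)) (G : ℕ → Set (V → ℕ)) (r₀ : ℕ) {q : ℝ}
    (hq : 0 ≤ q)
    (h : ∀ r, r₀ < r → ∀ D ∈ G r, (∀ v, D v ≤ r) →
      bernoulliExp (fun v => (D v : ℝ) / r) Finset.univ (fun e => if e ∈ S then 1 else 0) ≤ q)
    (k : ℕ) (D : V → ℕ) :
    ((exposedFamilies S G r₀ k D).card : ℝ) ≤ q ^ (k - r₀) * ∏ v, (k.choose (D v) : ℝ) := by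
  induction k generalizing D with
  | zero =>
    by_cases hD : D = 0
    · subst hD
      have := Finset.card_le_univ (exposedFamilies S G r₀ 0 (0 : V → ℕ))
      simp at this
      simpa using this
    · have : exposedFamilies S G r₀ 0 D = ∅ := by
        refine Finset.filter_false_of_mem fun e _ he => hD ?_
        rw [← he.1]
        funext v
        simp [tailDegree]
      rw [this]
      simp only [Finset.card_empty, Nat.cast_zero]
      positivity
  | succ k ih =>
    by_cases hD : ∀ v, D v ≤ k + 1
    swap
    · have : exposedFamilies S G r₀ (k + 1) D = ∅ := by
        refine Finset.filter_false_of_mem fun e _ he => hD fun v => ?_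
        rw [← he.1]
        exact tailDegree_le e 0 v
      rw [this]
      simp only [Finset.card_empty, Nat.cast_zero]
      positivity
    set p : V → ℝ := fun v => (D v : ℝ) / (k + 1 : ℕ) with hp
    set A := exposedFamilies S G r₀ (k + 1) D with hA
    set Q : ℝ := q ^ (k - r₀) * ∏ v, ((k + 1).choose (D v) : ℝ) with hQ
    have hQ0 : 0 ≤ Q := by positivity
    have hp0 : ∀ v, 0 ≤ p v := fun v => by positivity
    have hp1 : ∀ v, p v ≤ 1 := fun v => div_le_one_of_le₀ (by exact_mod_cast hD v) (by positivity)
    -- Fixing the first edge as `b` changes the binomial product by exactly the probability of `b`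
    -- under independent inclusion with probabilities `p`.
    have hfib (b : Finset V) : ((A.filter fun e => e 0 = b).card : ℝ) ≤
        Q * ∏ v, (if v ∈ b then p v else 1 - p v) := by
      -- This case is separated because the truncated subtraction in the remaining degrees below is
      -- only right when `D v` is positive on `b`.
      by_cases hb : ∃ v ∈ b, D v = 0
      · obtain ⟨v, hvb, hv⟩ := hb
        have : A.filter (fun e => e 0 = b) = ∅ := by
          refine Finset.filter_false_of_mem fun e he heb => ?_
          have h0 := congrFun (Finset.mem_filter.1 he).2.1 v
          rw [tailDegree_zero, heb, if_pos hvb] at h0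
          omega
        rw [this]
        simp only [Finset.card_empty, Nat.cast_zero]
        refine mul_nonneg hQ0 (Finset.prod_nonneg fun v _ => ?_)
        split_ifs
        · exact hp0 v
        · linarith [hp1 v]
      push Not at hb
      have hcard : (A.filter fun e => e 0 = b).card ≤
          (exposedFamilies S G r₀ k fun v => D v - if v ∈ b then 1 else 0).card := by
        refine Finset.card_le_card_of_injOn Fin.tail (fun e he => ?_) fun e he e' he' hee => ?_
        · obtain ⟨he, heb⟩ := Finset.mem_filter.1 he
          obtain ⟨h1, h2⟩ := (Finset.mem_filter.1 he).2
          refine Finset.mem_filter.2 ⟨Finset.mem_univ _, ?_, fun j hj => ?_⟩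
          · funext v
            rw [← h1, tailDegree_zero, heb]
            omega
          · have := h2 j.succ (by simp; omega)
            rw [Fin.val_succ, tailDegree_succ, Nat.add_sub_add_right] at this
            exact this
        · have h1 := (Finset.mem_filter.1 he).2
          have h2 := (Finset.mem_filter.1 he').2
          rw [← Fin.cons_self_tail e, ← Fin.cons_self_tail e', hee, h1, h2]
      calc ((A.filter fun e => e 0 = b).card : ℝ) ≤ _ := by exact_mod_cast hcard
        _ ≤ _ := ih _
        _ = Q * ∏ v, (if v ∈ b then p v else 1 - p v) := by
          rw [hQ, mul_assoc, ← Finset.prod_mul_distrib]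
          congr 1
          refine Finset.prod_congr rfl fun v _ => ?_
          split_ifs with hvb
          · obtain ⟨t, ht⟩ := Nat.exists_eq_succ_of_ne_zero (hb v hvb)
            simp only [hp, ht, Nat.succ_eq_add_one, Nat.add_sub_cancel]
            exact choose_mul_div.symm
          · exact (choose_mul_one_sub_div (hD v)).symm
    have hsum : (A.card : ℝ) = ∑ b : Finset V, ((A.filter fun e => e 0 = b).card : ℝ) := by
      exact_mod_cast Finset.card_eq_sum_card_fiberwise (f := fun e : Fin (k + 1) → Finset V => e 0) (t := Finset.univ)
        fun _ _ => Finset.mem_univ _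
    rw [hsum]
    have huniv (f : Finset V → ℝ) : bernoulliExp p Finset.univ f =
        ∑ b : Finset V, (∏ v, if v ∈ b then p v else 1 - p v) * f b := by
      simp [bernoulliExp]
    -- The last `r₀` edges are unconstrained: the Bernoulli weights sum to `1` and no factor `q` is
    -- gained.
    by_cases hk : k + 1 ≤ r₀
    · have e1 : k + 1 - r₀ = k - r₀ := by omega
      rw [e1]
      refine (Finset.sum_le_sum fun b _ => hfib b).trans (le_of_eq ?_)
      rw [← Finset.mul_sum]
      have := bernoulliExp_const (p := p) (T := Finset.univ) 1
      rw [huniv] at this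
      simp only [mul_one] at this
      rw [this, mul_one]
    · have hmem (e : Fin (k + 1) → Finset V) (he : e ∈ A) : e 0 ∈ S ∧ D ∈ G (k + 1) := by
        obtain ⟨h1, h2⟩ := (Finset.mem_filter.1 he).2
        have h3 := h2 0 (by simp; omega)
        simp only [Fin.val_zero, Nat.sub_zero, h1] at h3
        exact h3
      by_cases hG : D ∈ G (k + 1)
      swap
      · have hA0 : A = ∅ := Finset.eq_empty_of_forall_notMem fun e he => hG (hmem e he).2
        rw [hA0]
        simp only [Finset.filter_empty, Finset.card_empty, Nat.cast_zero, Finset.sum_const_zero]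
        positivity
      have e1 : k + 1 - r₀ = (k - r₀) + 1 := by omega
      have hstep := h (k + 1) (by omega) D hG hD
      calc ∑ b : Finset V, ((A.filter fun e => e 0 = b).card : ℝ)
          ≤ ∑ b : Finset V, Q * ((∏ v, if v ∈ b then p v else 1 - p v) *
            if b ∈ S then 1 else 0) := by
            refine Finset.sum_le_sum fun b _ => ?_
            split_ifs with hb
            · simpa using hfib b
            · have : A.filter (fun e => e 0 = b) = ∅ :=
                Finset.filter_false_of_mem fun e he heb => hb (heb ▸ (hmem e he).1)
              simp [this]
        _ = Q * bernoulliExp p Finset.univ (fun e => if e ∈ S then 1 else 0) := by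
          rw [huniv, Finset.mul_sum]
        _ ≤ Q * q := mul_le_mul_of_nonneg_left hstep hQ0
        _ = _ := by rw [hQ, e1, pow_succ]; ring

end Exposure

/-! ### Concentration for uniformly random sets of fixed size. -/

section Slices

variable {α : Type*} [Fintype α] [DecidableEq α]

theorem card_filter_mem_powersetCard {d : ℕ} (hd : 1 ≤ d) (hdm : d ≤ Fintype.card α) (i : α) :
    (((Finset.univ.powersetCard d).filter fun I : Finset α => i ∈ I).card : ℝ) =
      (Fintype.card α).choose d * (d / Fintype.card α) := by
  have h := Finset.card_filter_powersetCard_subset {i} (Finset.univ : Finset α) d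
    (Finset.subset_univ _) (by simpa using hd)
  simp only [Finset.singleton_subset_iff, Finset.card_singleton, Finset.card_univ] at h
  rw [h]
  obtain ⟨e, rfl⟩ := Nat.exists_eq_add_of_le' hd
  obtain ⟨M, hM⟩ := Nat.exists_eq_add_of_le' (hd.trans hdm)
  rw [hM]
  exact choose_mul_div.symm

/-- Negative correlation of two memberships: `(d - 1) / (m - 1) ≤ d / m`, with `m` the size of the
ground set. -/
theorem card_filter_mem_mem_powersetCard_le {d : ℕ} (hd : 2 ≤ d) (hdm : d ≤ Fintype.card α)
    {i j : α} (hij : i ≠ j) :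
    (((Finset.univ.powersetCard d).filter fun I : Finset α => i ∈ I ∧ j ∈ I).card : ℝ) ≤
      (Fintype.card α).choose d * (d / Fintype.card α) ^ 2 := by
  have h := Finset.card_filter_powersetCard_subset {i, j} (Finset.univ : Finset α) d
    (Finset.subset_univ _) (by rw [Finset.card_pair hij]; exact hd)
  simp only [Finset.insert_subset_iff, Finset.singleton_subset_iff, Finset.card_pair hij,
    Finset.card_univ] at h
  rw [h]
  obtain ⟨e, rfl⟩ := Nat.exists_eq_add_of_le' hd
  obtain ⟨M, hM⟩ := Nat.exists_eq_add_of_le' (hd.trans hdm)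
  rw [hM] at hdm ⊢
  have h1 := choose_mul_div (k := M + 1) (d := e + 1)
  have h2 := choose_mul_div (k := M) (d := e)
  simp only [Nat.add_sub_cancel]
  rw [← h2, ← h1, mul_assoc, sq]
  refine mul_le_mul_of_nonneg_left (mul_le_mul_of_nonneg_left ?_ (by positivity)) (by positivity)
  rw [div_le_div_iff₀ (by positivity) (by positivity)]
  have : (e : ℝ) ≤ M := by exact_mod_cast Nat.le_of_add_le_add_right hdm
  push_cast
  nlinarith

/-- The variance of the size of the intersection of a fixed set with a random `d`-set. -/
theorem sum_powersetCard_inter_sq_le {d : ℕ} (hd : 2 ≤ d) (hdm : d ≤ Fintype.card α)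
    (R : Finset α) :
    ∑ I ∈ (Finset.univ : Finset α).powersetCard d,
        (((R ∩ I).card : ℝ) - R.card * (d / Fintype.card α)) ^ 2 ≤
      (Fintype.card α).choose d * (R.card * (d / Fintype.card α)) := by
  set P := (Finset.univ : Finset α).powersetCard d with hP
  set N : ℝ := (((Fintype.card α).choose d : ℕ) : ℝ) with hN
  set x : ℝ := d / Fintype.card α with hx
  have hPN : (P.card : ℝ) = N := by rw [hP, Finset.card_powersetCard, Finset.card_univ]
  have hcard (I : Finset α) : ((R ∩ I).card : ℝ) = ∑ i ∈ R, if i ∈ I then (1 : ℝ) else 0 := by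
    rw [Finset.sum_boole, Finset.filter_mem_eq_inter]
  have h1 : ∑ I ∈ P, ((R ∩ I).card : ℝ) = R.card * (N * x) := by
    simp only [hcard]
    rw [Finset.sum_comm, ← nsmul_eq_mul, ← Finset.sum_const]
    refine Finset.sum_congr rfl fun i _ => ?_
    rw [Finset.sum_boole]
    exact card_filter_mem_powersetCard (by omega) hdm i
  have h2 : ∑ I ∈ P, ((R ∩ I).card : ℝ) ^ 2 ≤ R.card * (N * x) + R.card ^ 2 * (N * x ^ 2) := by
    have hsq (I : Finset α) : ((R ∩ I).card : ℝ) ^ 2 =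
        ∑ i ∈ R, ∑ j ∈ R, if i ∈ I ∧ j ∈ I then (1 : ℝ) else 0 := by
      rw [sq, hcard, Finset.sum_mul_sum]
      refine Finset.sum_congr rfl fun i _ => Finset.sum_congr rfl fun j _ => ?_
      split_ifs <;> simp_all
    have hij (i j : α) : ∑ I ∈ P, (if i ∈ I ∧ j ∈ I then (1 : ℝ) else 0) ≤
        (if i = j then N * x else 0) + N * x ^ 2 := by
      rw [Finset.sum_boole]
      by_cases h : i = j
      · subst h
        simp only [and_self, if_true]
        have : 0 ≤ N * x ^ 2 := by positivity
        linarith [card_filter_mem_powersetCard (by omega : 1 ≤ d) hdm i]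
      · rw [if_neg h, zero_add]
        exact card_filter_mem_mem_powersetCard_le hd hdm h
    calc ∑ I ∈ P, ((R ∩ I).card : ℝ) ^ 2
        = ∑ i ∈ R, ∑ j ∈ R, ∑ I ∈ P, (if i ∈ I ∧ j ∈ I then (1 : ℝ) else 0) := by
          simp only [hsq]
          rw [Finset.sum_comm]
          exact Finset.sum_congr rfl fun i _ => Finset.sum_comm
      _ ≤ ∑ i ∈ R, ∑ j ∈ R, ((if i = j then N * x else 0) + N * x ^ 2) :=
          Finset.sum_le_sum fun i _ => Finset.sum_le_sum fun j _ => hij i j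
      _ = _ := by
          simp only [Finset.sum_add_distrib, Finset.sum_const, nsmul_eq_mul, Finset.sum_ite_eq]
          rw [Finset.sum_ite_mem, Finset.inter_self, Finset.sum_const, nsmul_eq_mul]
          ring
  have h3 : ∀ I : Finset α, (((R ∩ I).card : ℝ) - R.card * x) ^ 2 =
      ((R ∩ I).card : ℝ) ^ 2 - 2 * (R.card * x) * ((R ∩ I).card : ℝ) + (R.card * x) ^ 2 :=
    fun I => by ring
  simp only [h3]
  rw [Finset.sum_add_distrib, Finset.sum_sub_distrib, ← Finset.mul_sum, h1, Finset.sum_const,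
    nsmul_eq_mul, hPN]
  nlinarith

/-- Chebyshev's inequality. -/
theorem card_filter_le_abs_inter_sub {d : ℕ} (hd : 2 ≤ d) (hdm : d ≤ Fintype.card α)
    (R : Finset α) {t δ : ℝ} (ht : 0 < t)
    (h : R.card * (d / Fintype.card α) ≤ δ * t ^ 2) :
    ((((Finset.univ : Finset α).powersetCard d).filter fun I =>
        t ≤ |((R ∩ I).card : ℝ) - R.card * (d / Fintype.card α)|).card : ℝ) ≤
      δ * (Fintype.card α).choose d := by
  have h1 := sum_powersetCard_inter_sq_le hd hdm R
  set f : Finset α → ℝ := fun I => ((R ∩ I).card : ℝ) - R.card * (d / Fintype.card α) with hf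
  set P := (Finset.univ : Finset α).powersetCard d with hP
  have h2 : ((P.filter fun I => t ≤ |f I|).card : ℝ) * t ^ 2 ≤ ∑ I ∈ P, f I ^ 2 := by
    rw [← nsmul_eq_mul, ← Finset.sum_const]
    refine le_trans (Finset.sum_le_sum fun I hI => ?_)
      (Finset.sum_le_sum_of_subset_of_nonneg (Finset.filter_subset _ _)
        fun I _ _ => sq_nonneg (f I))
    rw [← sq_abs (f I)]
    have := (Finset.mem_filter.1 hI).2
    gcongr
  have h3 : ((P.filter fun I => t ≤ |f I|).card : ℝ) * t ^ 2 ≤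
      (δ * (Fintype.card α).choose d) * t ^ 2 := by
    refine h2.trans (h1.trans ?_)
    have : (0 : ℝ) ≤ (Fintype.card α).choose d := by positivity
    nlinarith [mul_le_mul_of_nonneg_left h this]
  exact le_of_mul_le_mul_right h3 (by positivity)

/-- A large deviation bound: it is unlikely that half of `n` independent uniform elements of `P`
lie in a small subset. -/
theorem card_filter_half_bad_le {β : Type*} [DecidableEq β] {n : ℕ} (P : Finset β)
    (B : β → Prop) [DecidablePred B] {δ : ℝ} (hδ0 : 0 < δ) (hδ1 : δ ≤ 1)
    (hB : ((P.filter B).card : ℝ) ≤ δ ^ 2 * P.card) :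
    (((Fintype.piFinset fun _ : Fin n => P).filter fun I =>
        n ≤ 2 * (Finset.univ.filter fun v => B (I v)).card).card : ℝ) ≤
      (2 * δ) ^ n * P.card ^ n := by
  set F := Fintype.piFinset fun _ : Fin n => P
  -- Markov's inequality for a product weight: a bad coordinate counts `1 / δ ^ 2`, so half of them
  -- bad gives at least `(1 / δ) ^ n`, while the mean weight per coordinate is at most `2`.
  have hw : ∀ x, (0 : ℝ) ≤ if B x then (1 / δ ^ 2) else 1 := fun x => by split_ifs <;> positivity
  have h1 : (((F.filter fun I => n ≤ 2 * (Finset.univ.filter fun v => B (I v)).card).card : ℝ)) *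
      (1 / δ) ^ n ≤ ∑ I ∈ F, ∏ v, (if B (I v) then (1 / δ ^ 2) else 1) := by
    rw [← nsmul_eq_mul, ← Finset.sum_const]
    refine le_trans (Finset.sum_le_sum fun I hI => ?_)
      (Finset.sum_le_sum_of_subset_of_nonneg (Finset.filter_subset _ _)
        fun I _ _ => Finset.prod_nonneg fun v _ => hw _)
    have := (Finset.mem_filter.1 hI).2
    rw [Finset.prod_ite, Finset.prod_const, Finset.prod_const_one, mul_one, ← one_div_pow,
      ← pow_mul]
    exact pow_le_pow_right₀ (by rw [one_div]; exact (one_le_inv₀ hδ0).2 hδ1) this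
  have h2 : ∑ I ∈ F, ∏ v, (if B (I v) then (1 / δ ^ 2) else 1) =
      (∑ x ∈ P, if B x then (1 / δ ^ 2) else 1) ^ n := by
    have := Finset.prod_univ_sum (fun _ : Fin n => P)
      (fun _ x => if B x then (1 / δ ^ 2) else 1)
    rw [Finset.prod_const, Finset.card_univ, Fintype.card_fin] at this
    exact this.symm
  have h3 : (∑ x ∈ P, if B x then (1 / δ ^ 2) else 1) ≤ 2 * (P.card : ℝ) := by
    rw [Finset.sum_ite, Finset.sum_const, Finset.sum_const, nsmul_eq_mul, nsmul_eq_mul, mul_one]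
    have h4 : ((P.filter B).card : ℝ) * (1 / δ ^ 2) ≤ P.card := by
      rw [mul_one_div, div_le_iff₀ (by positivity)]
      linarith
    have h5 : ((P.filter fun x => ¬ B x).card : ℝ) ≤ P.card := by
      exact_mod_cast Finset.card_filter_le _ _
    linarith
  have h4 := h1.trans (h2.le.trans (pow_le_pow_left₀ (Finset.sum_nonneg fun x _ => hw x) h3 n))
  rw [one_div, inv_pow, ← div_eq_mul_inv, div_le_iff₀ (by positivity)] at h4
  refine h4.trans (le_of_eq ?_)
  rw [mul_pow, mul_pow]
  ring

end Slices

/-! ### Remaining degrees stay typical during the exposure. -/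

section Typical

variable {n m d : ℕ}

theorem tailDegree_ofIncidence (I : Fin n → Finset (Fin m)) (j : ℕ) (v : Fin n) :
    tailDegree (ofIncidence I) j v =
      ((Finset.univ.filter fun i : Fin m => j ≤ i) ∩ I v).card := by
  rw [tailDegree]
  congr 1
  ext i
  simp [ofIncidence]

theorem card_filter_le_val {j : ℕ} (hj : j ≤ m) :
    (Finset.univ.filter fun i : Fin m => j ≤ i).card = m - j := by
  have h := Finset.card_filter_add_card_filter_not (s := (Finset.univ : Finset (Fin m)))
    (fun i : Fin m => (i : ℕ) < j)
  rw [Fin.card_filter_val_lt, Finset.card_univ, Fintype.card_fin] at h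
  simp only [not_lt] at h
  omega

/-- Degree sequences with `r` edges left in which most degrees are close to `r * d / m`. -/
def typicalDegrees (n m d : ℕ) (η : ℝ) (r : ℕ) : Set (Fin n → ℕ) :=
  {D | 2 * (Finset.univ.filter fun v =>
    η / 2 * (r * (d / m : ℝ)) ≤ |(D v : ℝ) - r * (d / m : ℝ)|).card < n}

/-- At least `n / 2` vertices have `D v / r` within `η / 2 * x` of `x = d / m`. For these `D v / r ≥
x / 2` and `1 - D v / r ≥ η / 2`. -/
theorem le_bernoulliVar_of_mem_typicalDegrees {η : ℝ} (hη0 : 0 < η) (hη1 : η ≤ 1)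
    (hdm : (d / m : ℝ) ≤ 1 - η) {r : ℕ} (hr : 0 < r) {D : Fin n → ℕ}
    (hD : D ∈ typicalDegrees n m d η r) (hDr : ∀ v, D v ≤ r) :
    η / 8 * (d * n / m) ≤ bernoulliVar (fun v => (D v : ℝ) / r) Finset.univ := by
  set x : ℝ := d / m with hx
  have hx0 : 0 ≤ x := by positivity
  have hr' : (0 : ℝ) < r := by exact_mod_cast hr
  set W := Finset.univ.filter fun v => ¬ (η / 2 * (r * x) ≤ |(D v : ℝ) - r * x|) with hW
  have hWc : (n : ℝ) / 2 ≤ W.card := by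
    have h := Finset.card_filter_add_card_filter_not (s := (Finset.univ : Finset (Fin n)))
      (fun v => η / 2 * (r * x) ≤ |(D v : ℝ) - r * x|)
    rw [Finset.card_univ, Fintype.card_fin] at h
    have h2 : 2 * (Finset.univ.filter fun v =>
      η / 2 * (r * x) ≤ |(D v : ℝ) - r * x|).card < n := hD
    have h3 : (Finset.univ.filter fun v =>
        η / 2 * (r * x) ≤ |(D v : ℝ) - r * x|).card + W.card = n := by
      convert h
    have : n ≤ 2 * W.card := by omega
    have : (n : ℝ) ≤ 2 * W.card := by exact_mod_cast this
    linarith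
  have hp (v : Fin n) : 0 ≤ (D v : ℝ) / r * (1 - D v / r) := by
    refine mul_nonneg (by positivity) (sub_nonneg.2 (div_le_one_of_le₀ ?_ hr'.le))
    exact_mod_cast hDr v
  calc η / 8 * (d * n / m) = (n / 2) * (x / 2 * (η / 2)) := by rw [hx]; ring
    _ ≤ W.card * (x / 2 * (η / 2)) := by gcongr
    _ = ∑ v ∈ W, x / 2 * (η / 2) := by rw [Finset.sum_const, nsmul_eq_mul]
    _ ≤ ∑ v ∈ W, (D v : ℝ) / r * (1 - D v / r) := by
      refine Finset.sum_le_sum fun v hv => ?_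
      have hv := (Finset.mem_filter.1 hv).2
      push Not at hv
      obtain ⟨h1, h2⟩ := abs_lt.1 hv
      obtain ⟨y, hy⟩ : ∃ y : ℝ, (D v : ℝ) = r * y := ⟨D v / r, by field_simp⟩
      rw [hy] at h1 h2 ⊢
      rw [mul_div_cancel_left₀ _ hr'.ne']
      have h3 : -(η / 2 * x) < y - x := lt_of_mul_lt_mul_left (by linarith) hr'.le
      have h4 : y - x < η / 2 * x := lt_of_mul_lt_mul_left (by linarith) hr'.le
      have h5 : x / 2 ≤ y := by nlinarith
      have h6 : η / 2 ≤ 1 - y := by nlinarith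
      exact mul_le_mul h5 h6 (by positivity) (by linarith)
    _ ≤ _ := Finset.sum_le_sum_of_subset_of_nonneg (Finset.subset_univ _) fun v _ _ => hp v

-- A union bound over the exposure times. The hypothesis `hr` makes Chebyshev's failure probability
-- at most `δ ^ 2` per vertex whenever more than `r₀` edges are left; independence of the vertices
-- then gives `(2 * δ) ^ n`.
open Classical in
theorem card_filter_not_mem_typicalDegrees_le {η δ : ℝ} (hη0 : 0 < η) (hδ0 : 0 < δ) (hδ1 : δ ≤ 1)
    (hd : 2 ≤ d) (hdm : d ≤ m) {r₀ : ℕ} (hr : 4 * m ≤ δ ^ 2 * η ^ 2 * (d * r₀)) :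
    (((Fintype.piFinset fun _ : Fin n => (Finset.univ : Finset (Fin m)).powersetCard d).filter
      fun I => ∃ j : Fin m, j + r₀ < m ∧
        tailDegree (ofIncidence I) j ∉ typicalDegrees n m d η (m - j)).card : ℝ) ≤
      m * (2 * δ) ^ n * (m.choose d : ℝ) ^ n := by
  set P := (Finset.univ : Finset (Fin m)).powersetCard d with hP
  have hPN : P.card = m.choose d := by simp [hP]
  set F := Fintype.piFinset fun _ : Fin n => P with hF
  have hm : (0 : ℝ) < m := by exact_mod_cast (by omega : 0 < m)
  have hd' : (0 : ℝ) < d := by exact_mod_cast (by omega : 0 < d)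
  have hj (j : Fin m) : ((F.filter fun I => (j + r₀ < m ∧
      tailDegree (ofIncidence I) j ∉ typicalDegrees n m d η (m - j))).card : ℝ) ≤
      (2 * δ) ^ n * (m.choose d : ℝ) ^ n := by
    by_cases hjr : j + r₀ < m
    swap
    · rw [Finset.filter_false_of_mem fun I _ h => hjr h.1]
      simp only [Finset.card_empty, Nat.cast_zero]
      positivity
    set R := Finset.univ.filter fun i : Fin m => (j : ℕ) ≤ i with hR
    have hRc : R.card = m - j := card_filter_le_val j.2.le
    have hr0 : (r₀ : ℝ) ≤ R.card := by rw [hRc]; exact_mod_cast (by omega : r₀ ≤ m - j)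
    have hRpos : (0 : ℝ) < R.card := by rw [hRc]; exact_mod_cast (by omega : 0 < m - j)
    have hB := card_filter_le_abs_inter_sub (α := Fin m) hd (by simpa using hdm) R
      (t := η / 2 * (R.card * (d / m : ℝ))) (δ := δ ^ 2) (by positivity) (by
        rw [Fintype.card_fin]
        have : (4 : ℝ) ≤ δ ^ 2 * η ^ 2 * (R.card * (d / m)) := by
          rw [← mul_div_assoc, ← mul_div_assoc, le_div_iff₀ hm]
          refine hr.trans ?_
          rw [mul_comm (R.card : ℝ)]
          gcongr
        have h2 : 0 ≤ R.card * (d / m : ℝ) := by positivity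
        nlinarith [mul_le_mul_of_nonneg_right this h2])
    rw [Fintype.card_fin, ← hPN] at hB
    have := card_filter_half_bad_le (n := n) P (fun I => η / 2 * (R.card * (d / m : ℝ)) ≤
      |((R ∩ I).card : ℝ) - R.card * (d / m : ℝ)|) hδ0 hδ1 hB
    rw [hPN] at this
    refine le_trans ?_ this
    norm_cast
    refine Finset.card_le_card fun I hI => ?_
    obtain ⟨h1, -, h2⟩ := Finset.mem_filter.1 hI
    refine Finset.mem_filter.2 ⟨h1, ?_⟩
    simp only [typicalDegrees, Set.mem_ofPred_eq, not_lt, tailDegree_ofIncidence] at h2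
    rw [← hR, ← hRc] at h2
    exact h2
  have hsub : (F.filter fun I => ∃ j : Fin m, j + r₀ < m ∧
      tailDegree (ofIncidence I) j ∉ typicalDegrees n m d η (m - j)) ⊆
      Finset.univ.biUnion fun j : Fin m => F.filter fun I => (j + r₀ < m ∧
        tailDegree (ofIncidence I) j ∉ typicalDegrees n m d η (m - j)) := by
    intro I hI
    obtain ⟨h1, j, h2⟩ := Finset.mem_filter.1 hI
    exact Finset.mem_biUnion.2 ⟨j, Finset.mem_univ _, Finset.mem_filter.2 ⟨h1, h2⟩⟩
  have h1 := (Finset.card_le_card hsub).trans Finset.card_biUnion_le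
  calc _ ≤ ((∑ j : Fin m, (F.filter fun I => (j + r₀ < m ∧
        tailDegree (ofIncidence I) j ∉ typicalDegrees n m d η (m - j))).card : ℕ) : ℝ) := by
        exact_mod_cast h1
    _ ≤ ∑ j : Fin m, (2 * δ) ^ n * (m.choose d : ℝ) ^ n := by
        push_cast
        exact Finset.sum_le_sum fun j _ => hj j
    _ = _ := by
        rw [Finset.sum_const, nsmul_eq_mul, Finset.card_univ, Fintype.card_fin]
        ring

end Typical

/-! ### Conditional bounds for a single edge. -/

section RowBounds

variable {n : ℕ}

theorem colouring_cast_eq (ψ : Colouring n) (v : Fin n) : (ψ v : ℤ) = 1 ∨ (ψ v : ℤ) = -1 := by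
  rcases Int.units_eq_one_or (ψ v) with h | h <;> simp [h]

/-- At most `2 * Δ + 1 ≤ 3 * Δ` integers are possible values, each of probability at most `1 / √σ`.
-/
theorem bernoulliExp_abs_value_lt_le {p : Fin n → ℝ} (hp0 : ∀ v, 0 ≤ p v) (hp1 : ∀ v, p v ≤ 1)
    (ψ : Colouring n) {Δ σ : ℝ} (hΔ : 1 ≤ Δ) (hσ : 0 < σ) (h : σ ≤ bernoulliVar p Finset.univ) :
    bernoulliExp p Finset.univ (fun e => if |(ψ.value e : ℝ)| < Δ then 1 else 0) ≤
      3 * Δ / √σ := by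
  set M := ⌊Δ⌋ with hM
  have hM0 : 0 ≤ M := Int.floor_nonneg.2 (by linarith)
  have hx (x : ℤ) := bernoulliExp_eq_le (p := p) (T := Finset.univ) hp0 hp1
    (colouring_cast_eq ψ) x (hσ.trans_le h)
  have hsum (J : Finset ℤ) : bernoulliExp p Finset.univ
      (fun e => ∑ x ∈ J, if ψ.value e = x then 1 else 0) ≤ J.card * (1 / √σ) := by
    induction J using Finset.induction_on with
    | empty => simp [bernoulliExp_const]
    | insert a J ha ih =>
      simp only [Finset.sum_insert ha, Finset.card_insert_of_notMem ha, bernoulliExp_add]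
      have h1 : 1 / √(bernoulliVar p Finset.univ) ≤ 1 / √σ :=
        one_div_le_one_div_of_le (Real.sqrt_pos.2 hσ) (Real.sqrt_le_sqrt h)
      have h2 := (hx a).trans h1
      push_cast
      rw [add_mul, one_mul, add_comm]
      exact add_le_add ih h2
  calc _ ≤ bernoulliExp p Finset.univ
          (fun e => ∑ x ∈ Finset.Icc (-M) M, if ψ.value e = x then 1 else 0) := by
        refine bernoulliExp_mono hp0 hp1 fun e _ => ?_
        rw [Finset.sum_ite_eq]
        split_ifs with h1 h2 <;> norm_num
        refine h2 (Finset.mem_Icc.2 ?_)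
        rw [← abs_le]
        refine Int.le_floor.2 ?_
        push_cast
        exact h1.le
    _ ≤ (Finset.Icc (-M) M).card * (1 / √σ) := hsum _
    _ ≤ 3 * Δ * (1 / √σ) := by
        refine mul_le_mul_of_nonneg_right ?_ (by positivity)
        rw [Int.card_Icc]
        have h1 : (((M + 1 - -M).toNat : ℤ) : ℝ) = M + 1 - -M := by
          rw [Int.toNat_of_nonneg (by omega)]
          push_cast
          ring
        rw [← Int.cast_natCast, h1]
        have := Int.floor_le Δ
        linarith
    _ = _ := by ring

theorem value_eq_deviation_add (p : Fin n → ℝ) (ψ : Colouring n) (e : Finset (Fin n)) :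
    (ψ.value e : ℝ) = deviation p (fun v => ((ψ v : ℤ) : ℝ)) Finset.univ e +
      ∑ v, ((ψ v : ℤ) : ℝ) * p v := by
  rw [deviation, ← Finset.sum_add_distrib, Colouring.value]
  push_cast
  simp only [mul_sub, sub_add_cancel, mul_ite, mul_one, mul_zero, Finset.sum_ite_mem,
    Finset.univ_inter]

theorem bernoulliExp_abs_value_lt_le_one_sub {p : Fin n → ℝ} (hp0 : ∀ v, 0 ≤ p v)
    (hp1 : ∀ v, p v ≤ 1) (ψ : Colouring n) {Δ s : ℝ} (hs : 1 ≤ s) (K : ℕ)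
    (hT : (K + 1) * (s + 1) ≤ bernoulliVar p Finset.univ) (hΔ : Δ ≤ (K + 1) * (√s / 10)) :
    bernoulliExp p Finset.univ (fun e => if |(ψ.value e : ℝ)| < Δ then 1 else 0) ≤
      1 - (1 / 32) ^ (K + 1) := by
  -- Take `φ = ψ` or `φ = -ψ`, whichever has nonnegative mean; an upward deviation of `φ` then
  -- forces `|ψ(e)|` to be large.
  obtain ⟨φ, hφ, hdev⟩ : ∃ φ : Fin n → ℝ, (∀ v, φ v ^ 2 = 1) ∧
      ∀ e, deviation p φ Finset.univ e ≤ |(ψ.value e : ℝ)| := by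
    have hsq (v : Fin n) : ((ψ v : ℤ) : ℝ) ^ 2 = 1 := by
      rcases colouring_cast_eq ψ v with h | h <;> simp [h]
    rcases le_total 0 (∑ v, ((ψ v : ℤ) : ℝ) * p v) with h | h
    · refine ⟨fun v => ((ψ v : ℤ) : ℝ), hsq, fun e => ?_⟩
      refine le_trans ?_ (le_abs_self _)
      rw [value_eq_deviation_add p]
      linarith
    · refine ⟨fun v => -((ψ v : ℤ) : ℝ), fun v => by rw [neg_sq, hsq], fun e => ?_⟩
      refine le_trans ?_ (neg_le_abs _)
      rw [value_eq_deviation_add p]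
      have : deviation p (fun v => -((ψ v : ℤ) : ℝ)) Finset.univ e =
          -deviation p (fun v => ((ψ v : ℤ) : ℝ)) Finset.univ e := by
        simp [deviation]
      linarith
  have h1 := bernoulliExp_moderate_deviation (T := Finset.univ) hp0 hp1 hφ hs K hT
  have h2 := bernoulliExp_mono (T := Finset.univ) hp0 hp1
    (f := fun e => (if |(ψ.value e : ℝ)| < Δ then (1 : ℝ) else 0) +
      if (K + 1) * (√s / 10) ≤ deviation p φ Finset.univ e then 1 else 0) (g := fun _ => 1)
    (fun e _ => by
      split_ifs with h3 h4 <;> norm_num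
      linarith [hdev e])
  rw [bernoulliExp_add, bernoulliExp_const] at h2
  linarith

end RowBounds

/-! ### The first moment bound, the parity bound and the passage to probabilities. -/

section Counting

variable {n m d : ℕ}

theorem ofIncidence_injective : Function.Injective (ofIncidence : (Fin n → Finset (Fin m)) → _) := by
  intro I J h
  funext u
  ext i
  have := congrFun h i
  rw [Finset.ext_iff] at this
  simpa [ofIncidence] using this u

/-- An edge is needed: with none, the right side holds vacuously even for `x ≤ 0`. -/
theorem disc_lt_iff (H : Hypergraph n m) (hm : 0 < m) (x : ℝ) : (H.disc : ℝ) < x ↔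
    ∃ ψ : Colouring n, ∀ i, |(ψ.value (H i) : ℝ)| < x := by
  have habs (ψ : Colouring n) (i : Fin m) :
      |(ψ.value (H i) : ℝ)| = ((ψ.value (H i)).natAbs : ℝ) := by
    rw [Nat.cast_natAbs, Int.cast_abs]
  have hψ (ψ : Colouring n) :
      (H.colouringDisc ψ : ℝ) < x ↔ ∀ i, |(ψ.value (H i) : ℝ)| < x := by
    constructor
    · intro h i
      rw [habs]
      refine lt_of_le_of_lt ?_ h
      exact_mod_cast Finset.le_sup (f := fun i : Fin m => (ψ.value (H i)).natAbs)
        (Finset.mem_univ i)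
    · intro h
      obtain ⟨i, -, hi⟩ := Finset.exists_mem_eq_sup Finset.univ ⟨⟨0, hm⟩, Finset.mem_univ _⟩
        fun i : Fin m => (ψ.value (H i)).natAbs
      rw [Hypergraph.colouringDisc, hi, ← habs]
      exact h i
  constructor
  · intro h
    obtain ⟨ψ, -, hmin⟩ := Finset.exists_mem_eq_inf' Finset.univ_nonempty
      fun ψ : Colouring n => H.colouringDisc ψ
    rw [Hypergraph.disc, hmin] at h
    exact ⟨ψ, (hψ ψ).1 h⟩
  · rintro ⟨ψ, h⟩
    refine lt_of_le_of_lt ?_ ((hψ ψ).2 h)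
    exact_mod_cast Finset.inf'_le (fun ψ : Colouring n => H.colouringDisc ψ) (Finset.mem_univ ψ)

open Classical in
/-- The first moment bound: a bound on the conditional probability that one edge has small value
bounds the number of incidence families of small discrepancy. -/
theorem card_disc_lt_le {η δ q Δ : ℝ} (hη0 : 0 < η) (hη1 : η ≤ 1) (hδ0 : 0 < δ) (hδ1 : δ ≤ 1)
    (hd : 2 ≤ d) (hdm : d ≤ m) (hdη : (d / m : ℝ) ≤ 1 - η) {r₀ : ℕ}
    (hr : 4 * m ≤ δ ^ 2 * η ^ 2 * (d * r₀)) (hq : 0 ≤ q)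
    (hrow : ∀ p : Fin n → ℝ, (∀ v, 0 ≤ p v) → (∀ v, p v ≤ 1) →
      η / 8 * (d * n / m) ≤ bernoulliVar p Finset.univ → ∀ ψ : Colouring n,
      bernoulliExp p Finset.univ (fun e => if |(ψ.value e : ℝ)| < Δ then 1 else 0) ≤ q) :
    (((Fintype.piFinset fun _ : Fin n => (Finset.univ : Finset (Fin m)).powersetCard d).filter
      fun I => ((ofIncidence I).disc : ℝ) < Δ).card : ℝ) ≤
      (2 ^ n * q ^ (m - r₀) + m * (2 * δ) ^ n) * (m.choose d : ℝ) ^ n := by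
  set F := Fintype.piFinset fun _ : Fin n => (Finset.univ : Finset (Fin m)).powersetCard d with hF
  set S : Colouring n → Finset (Finset (Fin n)) := fun ψ =>
    Finset.univ.filter fun e => |(ψ.value e : ℝ)| < Δ with hS
  set G := typicalDegrees n m d η with hG
  set A : Colouring n → Finset (Fin n → Finset (Fin m)) := fun ψ => F.filter fun I =>
    ofIncidence I ∈ exposedFamilies (S ψ) G r₀ m (fun _ => d) with hA
  have hAc (ψ : Colouring n) : ((A ψ).card : ℝ) ≤ q ^ (m - r₀) * (m.choose d : ℝ) ^ n := by
    have h1 : (A ψ).card ≤ (exposedFamilies (S ψ) G r₀ m (fun _ => d)).card :=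
      Finset.card_le_card_of_injOn ofIncidence (fun I hI => (Finset.mem_filter.1 hI).2)
        ofIncidence_injective.injOn
    have h2 := card_exposedFamilies_le (S ψ) G r₀ hq (fun r hr D hD hDr => by
      have hr' : (0 : ℝ) < r := by exact_mod_cast (by omega : 0 < r)
      have := hrow _ (fun v => by positivity)
        (fun v => div_le_one_of_le₀ (by exact_mod_cast hDr v) hr'.le)
        (le_bernoulliVar_of_mem_typicalDegrees hη0 hη1 hdη (by omega) hD hDr) ψ
      simpa [hS] using this) m (fun _ => d)
    rw [Finset.prod_const, Finset.card_univ, Fintype.card_fin] at h2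
    exact le_trans (by exact_mod_cast h1) h2
  set B := F.filter fun I => ∃ j : Fin m, j + r₀ < m ∧
    tailDegree (ofIncidence I) j ∉ typicalDegrees n m d η (m - j) with hB
  have hBc : (B.card : ℝ) ≤ m * (2 * δ) ^ n * (m.choose d : ℝ) ^ n :=
    card_filter_not_mem_typicalDegrees_le hη0 hδ0 hδ1 hd hdm hr
  have hsub : F.filter (fun I => ((ofIncidence I).disc : ℝ) < Δ) ⊆
      (Finset.univ.biUnion A) ∪ B := by
    intro I hI
    obtain ⟨hIF, hI⟩ := Finset.mem_filter.1 hI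
    rw [Finset.mem_union]
    by_cases hIB : I ∈ B
    · exact Or.inr hIB
    left
    obtain ⟨ψ, hψ⟩ := (disc_lt_iff _ (by omega) _).1 hI
    refine Finset.mem_biUnion.2 ⟨ψ, Finset.mem_univ _, Finset.mem_filter.2 ⟨hIF,
      Finset.mem_filter.2 ⟨Finset.mem_univ _, ?_, fun j hj => ⟨?_, ?_⟩⟩⟩⟩
    · funext v
      have := (Finset.mem_powersetCard.1 (Fintype.mem_piFinset.1 hIF v)).2
      rw [tailDegree_ofIncidence]
      simpa using this
    · exact Finset.mem_filter.2 ⟨Finset.mem_univ _, hψ j⟩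
    · by_contra hcon
      exact hIB (Finset.mem_filter.2 ⟨hIF, j, hj, hcon⟩)
  have h1 := (Finset.card_le_card hsub).trans (Finset.card_union_le _ _)
  have h2 : ((Finset.univ.biUnion A).card : ℝ) ≤ 2 ^ n * (q ^ (m - r₀) * (m.choose d : ℝ) ^ n) := by
    calc ((Finset.univ.biUnion A).card : ℝ) ≤ ((∑ ψ, (A ψ).card : ℕ) : ℝ) := by
          exact_mod_cast Finset.card_biUnion_le
      _ ≤ ∑ ψ : Colouring n, q ^ (m - r₀) * (m.choose d : ℝ) ^ n := by
          push_cast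
          exact Finset.sum_le_sum fun ψ _ => hAc ψ
      _ = _ := by
          rw [Finset.sum_const, nsmul_eq_mul, Finset.card_univ]
          simp [Fintype.card_units_int]
  calc _ ≤ (((Finset.univ.biUnion A).card + B.card : ℕ) : ℝ) := by exact_mod_cast h1
    _ ≤ _ := by
      push_cast
      linarith

open Classical in
/-- By parity, the incidences of one vertex are determined by those of the other vertices if the
discrepancy vanishes. -/
theorem card_disc_lt_one_mul_le (hn : 0 < n) (hm : 0 < m) :
    ((Fintype.piFinset fun _ : Fin n => (Finset.univ : Finset (Fin m)).powersetCard d).filter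
      fun I => ((ofIncidence I).disc : ℝ) < 1).card * m.choose d ≤ m.choose d ^ n := by
  obtain ⟨k, rfl⟩ := Nat.exists_eq_add_of_le' hn
  rw [pow_succ]
  refine Nat.mul_le_mul_right _ ?_
  have hc : (Fintype.piFinset fun _ : Fin k => (Finset.univ : Finset (Fin m)).powersetCard d).card =
      m.choose d ^ k := by
    simp
  rw [← hc]
  have hpar (I : Fin (k + 1) → Finset (Fin m)) (hI : ((ofIncidence I).disc : ℝ) < 1) (i : Fin m) :
      i ∈ I 0 ↔ ¬ Even (Finset.univ.filter fun u : Fin k => i ∈ I u.succ).card := by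
    obtain ⟨ψ, hψ⟩ := (disc_lt_iff _ hm _).1 hI
    have h0 : ψ.value (ofIncidence I i) = 0 := by
      have := hψ i
      rw [← Int.cast_abs] at this
      exact Int.abs_lt_one_iff.1 (by exact_mod_cast this)
    -- Since `ψ v + 1` is `0` or `2`, `ψ(e)` and `|e|` have the same parity.
    have heven : Even (ofIncidence I i).card := by
      have h2 : ψ.value (ofIncidence I i) + (ofIncidence I i).card =
          ∑ v ∈ ofIncidence I i, ((ψ v : ℤ) + 1) := by
        rw [Finset.sum_add_distrib, Colouring.value]
        simp
      have h3 : Even (∑ v ∈ ofIncidence I i, ((ψ v : ℤ) + 1)) :=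
        Finset.even_sum _ fun v _ => by
          rcases colouring_cast_eq ψ v with h | h <;> rw [h] <;> decide
      rw [← h2, h0, zero_add] at h3
      exact_mod_cast h3
    rw [ofIncidence, Fin.card_filter_univ_succ] at heven
    split_ifs at heven with h
    · simpa [h] using Nat.even_add_one.1 heven
    · simpa [h] using heven
  refine Finset.card_le_card_of_injOn Fin.tail (fun I hI => ?_) fun I hI J hJ hIJ => ?_
  · exact Fintype.mem_piFinset.2 fun u =>
      Fintype.mem_piFinset.1 (Finset.mem_filter.1 hI).1 u.succ
  · have h0 : I 0 = J 0 := by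
      ext i
      rw [hpar I (Finset.mem_filter.1 hI).2, hpar J (Finset.mem_filter.1 hJ).2]
      have : ∀ u : Fin k, I u.succ = J u.succ := fun u => congrFun hIJ u
      simp only [this]
    rw [← Fin.cons_self_tail I, ← Fin.cons_self_tail J, hIJ, h0]

-- Each of the `(m.choose d) ^ n` admissible families has equal mass, so counting bounds become
-- probability bounds.
open Classical in
theorem edgeDependentModel_apply_le (hdm : d ≤ m) (A : Set (Hypergraph n m)) {b : ℝ}
    (h : (((Fintype.piFinset fun _ : Fin n => (Finset.univ : Finset (Fin m)).powersetCard d).filter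
      fun I => ofIncidence I ∈ A).card : ℝ) ≤ b * (m.choose d : ℝ) ^ n) :
    edgeDependentModel n m d A ≤ ENNReal.ofReal b := by
  set P := (Finset.univ : Finset (Finset (Fin m))).filter fun s => s.card = d with hP
  have hPs : {s : Finset (Fin m) | s.card = d} = (P : Set (Finset (Fin m))) := by
    ext s
    simp [hP]
  have hPp : (Finset.univ : Finset (Fin m)).powersetCard d = P := by
    ext s
    simp [hP]
  have hPc : P.card = m.choose d := by rw [← hPp]; simp
  have hN : 0 < m.choose d := Nat.choose_pos hdm
  have hprob := isProbabilityMeasure_uniformOn P.finite_toSet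
    (Finset.card_pos.1 (hPc ▸ hN))
  rw [hPp] at h
  set F := (Fintype.piFinset fun _ : Fin n => P).filter fun I => ofIncidence I ∈ A with hF
  have hsing (I : Fin n → Finset (Fin m)) :
      (Measure.pi fun _ : Fin n => uniformOn (P : Set (Finset (Fin m)))) {I} =
        if I ∈ Fintype.piFinset (fun _ : Fin n => P) then ((m.choose d : ENNReal)⁻¹) ^ n else 0 := by
    rw [Measure.pi_singleton]
    have hone (s : Finset (Fin m)) : uniformOn (P : Set (Finset (Fin m))) {s} =
        if s ∈ P then (m.choose d : ENNReal)⁻¹ else 0 := by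
      rw [← Finset.coe_singleton, uniformOn_apply_finset, hPc]
      split_ifs with hs
      · rw [Finset.inter_singleton_of_mem hs]
        simp
      · rw [Finset.inter_singleton_of_notMem hs]
        simp
    simp only [hone]
    split_ifs with hI
    · rw [Finset.prod_congr rfl fun v _ => if_pos (Fintype.mem_piFinset.1 hI v)]
      simp
    · rw [Fintype.mem_piFinset, not_forall] at hI
      obtain ⟨v, hv⟩ := hI
      exact Finset.prod_eq_zero (Finset.mem_univ v) (if_neg hv)
  rw [edgeDependentModel, hPs, Measure.map_apply (measurable_of_countable _)
    (Set.toFinite _).measurableSet]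
  set μ := Measure.pi fun _ : Fin n => uniformOn (P : Set (Finset (Fin m)))
  have hsum : μ (ofIncidence ⁻¹' A) = (F.card : ENNReal) * ((m.choose d : ENNReal)⁻¹) ^ n := by
    set E := (Finset.univ : Finset (Fin n → Finset (Fin m))).filter fun I => ofIncidence I ∈ A
    have hE : ofIncidence ⁻¹' A = (E : Set (Fin n → Finset (Fin m))) := by
      ext I
      simp [E]
    rw [hE, ← sum_measure_singleton]
    simp only [hsing]
    rw [← Finset.sum_filter, Finset.sum_const, nsmul_eq_mul]
    congr 3
    ext I
    simp [E, hF, and_comm]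
  have hNr : (0 : ℝ) < (m.choose d : ℝ) ^ n := by positivity
  rw [hsum]
  have hconv : (F.card : ENNReal) * ((m.choose d : ENNReal)⁻¹) ^ n =
      ENNReal.ofReal (F.card / (m.choose d : ℝ) ^ n) := by
    rw [ENNReal.ofReal_div_of_pos hNr, ENNReal.ofReal_natCast, ENNReal.ofReal_pow (by positivity),
      ENNReal.ofReal_natCast, ← ENNReal.inv_pow, div_eq_mul_inv]
  rw [hconv]
  exact ENNReal.ofReal_le_ofReal ((div_le_iff₀ hNr).2 h)

theorem isProbabilityMeasure_edgeDependentModel (hdm : d ≤ m) :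
    IsProbabilityMeasure (edgeDependentModel n m d) := by
  have hne : {s : Finset (Fin m) | s.card = d}.Nonempty := by
    obtain ⟨s, -, hs⟩ := Finset.exists_subset_card_eq
      (s := (Finset.univ : Finset (Fin m))) (n := d) (by simpa using hdm)
    exact ⟨s, hs⟩
  have := isProbabilityMeasure_uniformOn (Set.toFinite {s : Finset (Fin m) | s.card = d}) hne
  exact Measure.isProbabilityMeasure_map (measurable_of_countable _).aemeasurable

end Counting

/-! ### Choice of parameters in the two regimes. -/

section Discrepancy

variable {n m d : ℕ} {η t : ℝ}

/-- With `t` the fourth root of `d`, take `δ = 2 / (η * t)` and `r₀ = ⌈m / t ^ 2⌉₊`. Both `δ` and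
`r₀ / m` become small, while `δ ^ 2 * η ^ 2 * d * r₀` is still at least `4 * m`. -/
theorem edgeDependentModel_disc_lt_le {q Δ : ℝ} (hη0 : 0 < η) (hη1 : η ≤ 1) (ht : t ^ 4 = d)
    (htη : 8 / η ≤ t) (hn : 4 ≤ n) (hdm : d ≤ m) (hdη : (d / m : ℝ) ≤ 1 - η) (hmn : m ≤ d * n)
    (hq : 0 ≤ q)
    (hrow : ∀ p : Fin n → ℝ, (∀ v, 0 ≤ p v) → (∀ v, p v ≤ 1) →
      η / 8 * (d * n / m) ≤ bernoulliVar p Finset.univ → ∀ ψ : Colouring n,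
      bernoulliExp p Finset.univ (fun e => if |(ψ.value e : ℝ)| < Δ then 1 else 0) ≤ q) :
    edgeDependentModel n m d {H | (H.disc : ℝ) < Δ} ≤
      ENNReal.ofReal (2 ^ n * q ^ (m - ⌈m / t ^ 2⌉₊) + 4096 / η ^ 4 * (n * (1 / 2) ^ n)) := by
  have ht8 : 8 ≤ t := le_trans (by rw [le_div_iff₀ hη0]; linarith) htη
  have hηt : 8 ≤ η * t := by rw [div_le_iff₀ hη0] at htη; linarith
  have hd : 2 ≤ d := by
    have : (2 : ℝ) ≤ d := by
      rw [← ht]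
      calc (2 : ℝ) ≤ 8 ^ 4 := by norm_num
        _ ≤ t ^ 4 := by gcongr
    exact_mod_cast this
  have hδ1 : 2 / (η * t) ≤ 1 := div_le_one_of_le₀ (by linarith) (by linarith)
  refine edgeDependentModel_apply_le hdm _ ((card_disc_lt_le (δ := 2 / (η * t)) hη0 hη1
    (by positivity) hδ1 hd hdm hdη (r₀ := ⌈m / t ^ 2⌉₊) ?_ hq hrow).trans ?_)
  · have h1 : (m : ℝ) / t ^ 2 ≤ ⌈m / t ^ 2⌉₊ := Nat.le_ceil _
    rw [← ht, div_pow, mul_pow]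
    rw [div_le_iff₀ (by positivity)] at h1
    field_simp
    linarith
  · refine mul_le_mul_of_nonneg_right ?_ (by positivity)
    refine add_le_add le_rfl ?_
    -- Four of the `n` factors `2 * δ` absorb the `t ^ 4` in `m ≤ t ^ 4 * n`; each remaining factor
    -- is at most `1 / 2`.
    obtain ⟨k, rfl⟩ := Nat.exists_eq_add_of_le' hn
    have h2 : (2 * (2 / (η * t))) ^ k ≤ (1 / 2) ^ k := by
      refine pow_le_pow_left₀ (by positivity) ?_ k
      rw [← mul_div_assoc, div_le_iff₀ (by linarith)]
      linarith
    have hm : (m : ℝ) ≤ t ^ 4 * (k + 4 : ℕ) := by rw [ht]; exact_mod_cast hmn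
    calc (m : ℝ) * (2 * (2 / (η * t))) ^ (k + 4)
        ≤ (t ^ 4 * (k + 4 : ℕ)) * (2 * (2 / (η * t))) ^ (k + 4) := by gcongr
      _ = 256 / η ^ 4 * ((k + 4 : ℕ) * (2 * (2 / (η * t))) ^ k) := by
        rw [pow_add]
        field_simp
        ring
      _ ≤ 256 / η ^ 4 * ((k + 4 : ℕ) * (1 / 2) ^ k) := by gcongr
      _ = 4096 / η ^ 4 * ((k + 4 : ℕ) * (1 / 2) ^ (k + 4)) := by ring

/-- The hypothesis says `4 ^ x < X`, and `x ≤ exp y` for the `y` with `exp (3 * y) = 4 ^ x`. In the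
dense regime this gives `n / m ≤ √d`. -/
theorem cube_le_of_one_lt_two_rpow_neg_mul_sqrt {X x : ℝ} (hx : 0 < x) (hX : 0 ≤ X)
    (h : 1 < (2 : ℝ) ^ (-x) * √X) : x ^ 3 ≤ X := by
  set y := 2 * Real.log 2 / 3 * x with hy
  have h1 : x ≤ Real.exp y := by
    have h2 := Real.add_one_le_exp (y - 1)
    rw [sub_add_cancel, Real.exp_sub, le_div_iff₀ (Real.exp_pos 1)] at h2
    refine le_trans ?_ h2
    have h3 := Real.log_two_gt_d9
    have h4 := Real.exp_one_gt_d9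
    have h5 : (46 / 100 : ℝ) * x ≤ y := by rw [hy]; nlinarith
    nlinarith
  have h2 : Real.exp y ^ 3 = ((2 : ℝ) ^ x) ^ 2 := by
    rw [Real.rpow_def_of_pos (by norm_num), ← Real.exp_nat_mul, ← Real.exp_nat_mul, hy]
    congr 1
    push_cast
    ring
  have h3 : (2 : ℝ) ^ x ≤ √X := by
    rw [Real.rpow_neg (by norm_num), inv_mul_eq_div, one_lt_div (by positivity)] at h
    exact h.le
  calc x ^ 3 ≤ Real.exp y ^ 3 := by gcongr
    _ = ((2 : ℝ) ^ x) ^ 2 := h2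
    _ ≤ √X ^ 2 := by gcongr
    _ = X := Real.sq_sqrt hX

theorem ceil_div_le (ht8 : 8 ≤ t) (ht : t ^ 4 = d) (hdm : d ≤ m) :
    (⌈m / t ^ 2⌉₊ : ℝ) ≤ 2 * m / t ^ 2 := by
  have h1 := (Nat.ceil_lt_add_one (by positivity : (0 : ℝ) ≤ m / t ^ 2)).le
  have h2 : 1 ≤ m / t ^ 2 := by
    rw [le_div_iff₀ (by positivity), one_mul]
    have : (d : ℝ) ≤ m := by exact_mod_cast hdm
    have h64 : 64 ≤ t ^ 2 := by nlinarith
    have h4 : t ^ 4 = t ^ 2 * t ^ 2 := by ring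
    nlinarith
  calc _ ≤ _ := h1
    _ ≤ m / t ^ 2 + m / t ^ 2 := by linarith
    _ = _ := by ring

theorem half_le_sub_ceil (ht8 : 8 ≤ t) (ht : t ^ 4 = d) (hdm : d ≤ m) :
    (m : ℝ) / 2 ≤ (m - ⌈m / t ^ 2⌉₊ : ℕ) := by
  have h1 := ceil_div_le ht8 ht hdm
  have h2 : 2 * m / t ^ 2 ≤ (m : ℝ) / 2 := by
    rw [div_le_div_iff₀ (by positivity) (by norm_num)]
    have h64 : 64 ≤ t ^ 2 := by nlinarith
    have : (0 : ℝ) ≤ m := by positivity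
    nlinarith [mul_le_mul_of_nonneg_left h64 this]
  have h3 : (m : ℝ) ≤ (m - ⌈m / t ^ 2⌉₊ : ℕ) + (⌈m / t ^ 2⌉₊ : ℝ) := by
    norm_cast
    omega
  linarith

/-- The parity bound is `1 / m.choose d`, and `d < m` gives `m.choose d ≥ d + 1`. -/
theorem edgeDependentModel_disc_lt_one_le (hn : 0 < n) (hd : 0 < d) (hdm : d < m) :
    edgeDependentModel n m d {H | (H.disc : ℝ) < 1} ≤ ENNReal.ofReal (1 / d) := by
  classical
  refine edgeDependentModel_apply_le hdm.le _ ?_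
  have h1 := card_disc_lt_one_mul_le (d := d) hn (hd.trans hdm)
  have h2 : d ≤ m.choose d := by
    have := Nat.choose_le_choose d (Nat.succ_le_of_lt hdm)
    rw [Nat.succ_eq_add_one, Nat.choose_succ_self_right] at this
    omega
  rw [one_div, le_inv_mul_iff₀ (by exact_mod_cast hd), mul_comm]
  exact_mod_cast (Nat.mul_le_mul_left _ h2).trans h1

/-- The lower bound on the discrepancy in the dense regime. -/
theorem edgeDependentModel_disc_lt_max_le (hη0 : 0 < η) (hη1 : η ≤ 1) (ht : t ^ 4 = d)
    (htη : 8 / η ≤ t) (hn : 4 ≤ n) (hdm : d < m) (hdη : (d / m : ℝ) ≤ 1 - η) (hmn : m ≤ d * n) :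
    edgeDependentModel n m d
      {H | (H.disc : ℝ) < √η / 1000 * max ((2 : ℝ) ^ (-((n : ℝ) / m)) * √(d * n / m)) 1} ≤
      ENNReal.ofReal (1 / d + 4096 / η ^ 4 * (n * (1 / 2) ^ n)) := by
  have ht8 : 8 ≤ t := le_trans (by rw [le_div_iff₀ hη0]; linarith) htη
  have hd0 : (0 : ℝ) < d := by rw [← ht]; positivity
  have hm0 : (0 : ℝ) < m := hd0.trans (by exact_mod_cast hdm)
  have hn0 : (0 : ℝ) < n := by exact_mod_cast (by omega : 0 < n)
  set x : ℝ := n / m with hx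
  set X : ℝ := d * n / m with hX
  have hx0 : 0 < x := by positivity
  have hX0 : 0 < X := by positivity
  set a := (2 : ℝ) ^ (-x) * √X with ha
  set κ := √η / 1000 with hκ
  have hκ0 : 0 < κ := by positivity
  have hκ1 : κ ≤ 1 := by
    have : √η ≤ 1 := Real.sqrt_le_one.2 hη1
    rw [hκ]
    linarith
  have herr : 0 ≤ 4096 / η ^ 4 * (n * (1 / 2 : ℝ) ^ n) := by positivity
  -- If `κ * a ≤ 1` the threshold is at most `1` and parity suffices. Otherwise `1 < a`, which also
  -- keeps `n / m` below `t ^ 2`.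
  rcases le_or_gt (κ * a) 1 with hκa | hκa
  · have hsub : {H : Hypergraph n m | (H.disc : ℝ) < κ * max a 1} ⊆ {H | (H.disc : ℝ) < 1} := by
      intro H (hH : (H.disc : ℝ) < κ * max a 1)
      refine lt_of_lt_of_le hH ?_
      rcases max_choice a 1 with h | h <;> rw [h] <;> linarith
    refine (measure_mono hsub).trans ((edgeDependentModel_disc_lt_one_le (by omega)
      (by exact_mod_cast hd0) hdm).trans (ENNReal.ofReal_le_ofReal (by linarith)))
  · have ha1 : 1 < a := by nlinarith
    rw [max_eq_left ha1.le]
    have hσ : 0 < η / 8 * X := by positivity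
    have hsqrt : √η / 3 * √X ≤ √(η / 8 * X) := by
      refine Real.le_sqrt_of_sq_le ?_
      rw [mul_pow, div_pow, Real.sq_sqrt hη0.le, Real.sq_sqrt hX0.le]
      have : 0 < η * X := by positivity
      linarith
    have h2x : (0 : ℝ) < 2 ^ (-x) := by positivity
    refine (edgeDependentModel_disc_lt_le hη0 hη1 ht htη hn hdm.le hdη hmn
      (q := (2 : ℝ) ^ (-x) / 64) (by positivity) (fun p hp0 hp1 hp ψ => ?_)).trans
      (ENNReal.ofReal_le_ofReal (add_le_add_left ?_ _))
    · refine (bernoulliExp_abs_value_lt_le hp0 hp1 ψ hκa.le hσ hp).trans ?_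
      rw [div_le_iff₀ (by positivity)]
      calc 3 * (κ * a) = 2 ^ (-x) / 64 * (192 / 1000 * (√η * √X)) := by rw [hκ, ha]; ring
        _ ≤ 2 ^ (-x) / 64 * (√η / 3 * √X) := by
          gcongr ?_ * ?_
          have : 0 < √η * √X := by positivity
          linarith
        _ ≤ _ := by gcongr
    · set r := ⌈m / t ^ 2⌉₊ with hr
      have hr1 := ceil_div_le ht8 ht hdm.le
      have hr2 := half_le_sub_ceil ht8 ht hdm.le
      rw [← hr] at hr1 hr2
      have hxt : x ≤ t ^ 2 := by
        have h1 := cube_le_of_one_lt_two_rpow_neg_mul_sqrt hx0 hX0.le ha1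
        have h2 : X = t ^ 4 * x := by rw [ht, hX, hx]; ring
        rw [h2] at h1
        have h3 : x ^ 2 ≤ (t ^ 2) ^ 2 := by
          refine le_of_mul_le_mul_right ?_ hx0
          calc x ^ 2 * x = x ^ 3 := by ring
            _ ≤ _ := h1
            _ = _ := by ring
        exact le_of_sq_le_sq h3 (by positivity)
      have hxr : x * r ≤ 2 * m := by
        calc x * r ≤ t ^ 2 * (2 * m / t ^ 2) := by gcongr
          _ = 2 * m := by field_simp
      have hmr : ((m - r : ℕ) : ℝ) ≥ m - r := by
        have : (m : ℝ) ≤ (m - r : ℕ) + (r : ℝ) := by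
          norm_cast
          omega
        linarith
      have hnx : (n : ℝ) = x * m := by rw [hx]; field_simp
      have e1 : (2 : ℝ) ^ n * (2 ^ (-x) / 64) ^ (m - r) =
          2 ^ ((n : ℝ) + (-x - 6) * (m - r : ℕ)) := by
        have : (2 : ℝ) ^ (-x) / 64 = 2 ^ (-x - 6) := by
          rw [Real.rpow_sub (by norm_num)]
          norm_num
        rw [this, Real.rpow_add (by norm_num), Real.rpow_natCast, Real.rpow_mul (by norm_num),
          Real.rpow_natCast]
      rw [e1]
      -- The `r` unexposed edges cost `x * r ≤ 2 * m` in the exponent. The factor `1 / 64` in `q`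
      -- gains `6 * (m - r) ≥ 3 * m`, which leaves at most `-m ≤ -d`.
      calc (2 : ℝ) ^ ((n : ℝ) + (-x - 6) * (m - r : ℕ)) ≤ 2 ^ (-(d : ℝ)) := by
            refine Real.rpow_le_rpow_of_exponent_le (by norm_num) ?_
            have h1 : x * ((m - r : ℕ) : ℝ) ≥ x * (m - r) := by gcongr
            have h2 : (d : ℝ) ≤ m := by exact_mod_cast hdm.le
            rw [hnx]
            nlinarith
        _ ≤ 1 / d := by
            rw [Real.rpow_neg (by norm_num), Real.rpow_natCast, ← one_div]
            refine one_div_le_one_div_of_le hd0 ?_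
            exact_mod_cast Nat.lt_two_pow_self.le

/-- The lower bound on the discrepancy in the sparse regime. -/
theorem edgeDependentModel_disc_lt_sqrt_le (hη0 : 0 < η) (hη1 : η ≤ 1) (ht : t ^ 4 = d)
    (htη : 8 / η ≤ t) (hn : 4 ≤ n) (hdm : d < m) (hdη : (d / m : ℝ) ≤ 1 - η) (hmn : m ≤ d * n)
    (hw : 16 ≤ (m / n : ℝ)) (hX8 : 8 / η ≤ √(d * n / m))
    (hL : 7 ≤ Real.log (min ((m : ℝ) / n) (d * n / m))) :
    edgeDependentModel n m d {H | (H.disc : ℝ) <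
      √η / 1000 * √(d * n / m * Real.log (min ((m : ℝ) / n) (d * n / m)))} ≤
      ENNReal.ofReal (Real.exp (-n) + 4096 / η ^ 4 * (n * (1 / 2) ^ n)) := by
  have ht8 : 8 ≤ t := le_trans (by rw [le_div_iff₀ hη0]; linarith) htη
  have hd0 : (0 : ℝ) < d := by rw [← ht]; positivity
  have hm0 : (0 : ℝ) < m := hd0.trans (by exact_mod_cast hdm)
  have hn0 : (0 : ℝ) < n := by exact_mod_cast (by omega : 0 < n)
  set X : ℝ := d * n / m with hX
  have hX0 : 0 < X := by positivity
  set γ := min ((m : ℝ) / n) X with hγ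
  have hγ0 : 0 < γ := lt_min (by positivity) hX0
  set L := Real.log γ with hLdef
  -- The divisor `7` comes from `log 32 ≤ 7 / 2`: with `K + 1 ≤ L / 7` blocks, `32 ^ (-(K + 1)) ≥
  -- exp (-L / 2) ≥ √(n / m)`.
  obtain ⟨K, hK⟩ : ∃ K : ℕ, ⌊L / 7⌋₊ = K + 1 := Nat.exists_eq_add_of_le'
    (Nat.le_floor (by push_cast; linarith))
  have hK1 : (K + 1 : ℝ) ≤ L / 7 := by
    have := Nat.floor_le (by linarith : 0 ≤ L / 7)
    rw [hK] at this
    exact_mod_cast this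
  have hK2 : L / 14 ≤ (K + 1 : ℝ) := by
    have := Nat.lt_floor_add_one (L / 7)
    rw [hK] at this
    push_cast at this
    have h0 : (0 : ℝ) ≤ K := K.cast_nonneg
    linarith
  have hKpos : (0 : ℝ) < K + 1 := by positivity
  set σ := η / 8 * X with hσ
  have hLX : L ≤ 2 * √X := by
    have h1 : L ≤ Real.log X := Real.log_le_log hγ0 (min_le_right _ _)
    have h2 : Real.log X = 2 * Real.log (√X) := by
      rw [Real.log_sqrt hX0.le]
      ring
    have h3 := Real.log_le_sub_one_of_pos (Real.sqrt_pos.2 hX0)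
    linarith
  -- The bound `γ ≤ dn/m` enters here: the number of blocks is small against the variance. Blocks
  -- with `s = σ / (2 * (K + 1))` use half of `σ`, and the other half pays for overshoots of at most
  -- `1` each.
  have hKσ : 2 * (K + 1 : ℝ) ≤ σ := by
    have h1 : √X * √X = X := Real.mul_self_sqrt hX0.le
    have h2 : 8 ≤ η * √X := by rw [div_le_iff₀ hη0] at hX8; linarith
    have h3 : 0 < √X := Real.sqrt_pos.2 hX0
    have h4 : √X ≤ σ := by
      have h5 : σ = η * √X * √X / 8 := by rw [hσ, mul_assoc, h1]; ring
      rw [h5]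
      nlinarith
    linarith
  have hs : 1 ≤ σ / (2 * (K + 1)) := by rwa [one_le_div (by positivity)]
  have hlog32 : Real.log 32 ≤ 7 / 2 := by
    have : (32 : ℝ) = 2 ^ 5 := by norm_num
    rw [this, Real.log_pow]
    have := Real.log_two_lt_d9
    push_cast
    linarith
  set w := √((m : ℝ) / n) with hwdef
  have hw2 : w ^ 2 = m / n := Real.sq_sqrt (by positivity)
  have hw4 : 4 ≤ w := Real.le_sqrt_of_sq_le (by linarith)
  have hq1 : 1 / w ≤ (1 / 32 : ℝ) ^ (K + 1) := by
    have e1 : (1 / 32 : ℝ) ^ (K + 1) = Real.exp (-((K + 1) * Real.log 32)) := by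
      rw [Real.exp_neg, ← Nat.cast_add_one, Real.exp_nat_mul, Real.exp_log (by norm_num),
        one_div, inv_pow]
    have e2 : 1 / w = Real.exp (-(Real.log ((m : ℝ) / n) / 2)) := by
      rw [← Real.log_sqrt (by positivity), Real.exp_neg, Real.exp_log (by linarith), one_div]
    rw [e1, e2]
    have h1 : L ≤ Real.log ((m : ℝ) / n) := Real.log_le_log hγ0 (min_le_left _ _)
    refine Real.exp_le_exp.2 (neg_le_neg ?_)
    calc (K + 1) * Real.log 32 ≤ L / 7 * (7 / 2) := by
          gcongr
      _ ≤ _ := by linarith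
  have hq0 : (1 / 32 : ℝ) ^ (K + 1) ≤ 1 := pow_le_one₀ (by norm_num) (by norm_num)
  refine (edgeDependentModel_disc_lt_le hη0 hη1 ht htη hn hdm.le hdη hmn
    (q := 1 - (1 / 32 : ℝ) ^ (K + 1)) (by linarith) (fun p hp0 hp1 hp ψ => ?_)).trans
    (ENNReal.ofReal_le_ofReal (add_le_add_left ?_ _))
  · refine bernoulliExp_abs_value_lt_le_one_sub hp0 hp1 ψ hs K (le_trans ?_ hp) ?_
    · have : (K + 1 : ℝ) * (σ / (2 * (K + 1)) + 1) = σ / 2 + (K + 1) := by field_simp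
      rw [this]
      linarith
    · refine le_of_sq_le_sq ?_ (by positivity)
      have hL0 : 0 ≤ L := by linarith
      rw [mul_pow, mul_pow, div_pow, div_pow, Real.sq_sqrt hη0.le, Real.sq_sqrt (by positivity),
        Real.sq_sqrt (by positivity)]
      have e1 : (K + 1 : ℝ) ^ 2 * (σ / (2 * (K + 1)) / 10 ^ 2) = (K + 1) * (η * X) / 1600 := by
        rw [hσ]
        field_simp
        norm_num
      rw [e1]
      have h1 : L / 14 * (η * X) ≤ (K + 1) * (η * X) := by gcongr
      have h2 : 0 ≤ L * (η * X) := by positivity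
      linarith
  · set r := ⌈m / t ^ 2⌉₊ with hr
    have hr2 := half_le_sub_ceil ht8 ht hdm.le
    rw [← hr] at hr2
    have hmw : (m : ℝ) = n * w ^ 2 := by rw [hw2]; field_simp
    have h1 : (1 - (1 / 32 : ℝ) ^ (K + 1)) ^ (m - r) ≤ Real.exp (-(2 * n)) := by
      calc (1 - (1 / 32 : ℝ) ^ (K + 1)) ^ (m - r) ≤ Real.exp (-(1 / w)) ^ (m - r) := by
            refine pow_le_pow_left₀ (by linarith) ?_ _
            have := Real.one_sub_le_exp_neg (1 / w)
            linarith
        _ = Real.exp (-(((m - r : ℕ) : ℝ) * (1 / w))) := by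
            rw [← Real.exp_nat_mul, mul_neg]
        _ ≤ Real.exp (-(2 * n)) := by
            refine Real.exp_le_exp.2 (neg_le_neg ?_)
            calc (2 * n : ℝ) ≤ n * w / 2 := by nlinarith
              _ = m / 2 * (1 / w) := by rw [hmw]; field_simp
              _ ≤ _ := by gcongr
    have h2 : (2 : ℝ) ^ n ≤ Real.exp n := by
      rw [← mul_one (n : ℝ), Real.exp_nat_mul]
      refine pow_le_pow_left₀ (by norm_num) ?_ n
      linarith [Real.exp_one_gt_d9]
    calc _ ≤ Real.exp n * Real.exp (-(2 * n)) := by gcongr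
      _ = Real.exp (-n) := by
        rw [← Real.exp_add]
        ring_nf

theorem tendsto_measure_le_disc {m d : ℕ → ℕ} (hdm : ∀ᶠ n in atTop, d n ≤ m n) {f b : ℕ → ℝ}
    (hb : Tendsto b atTop (𝓝 0))
    (h : ∀ᶠ n in atTop, edgeDependentModel n (m n) (d n) {H | (H.disc : ℝ) < f n} ≤
      ENNReal.ofReal (b n)) :
    Tendsto (fun n => edgeDependentModel n (m n) (d n) {H | f n ≤ (H.disc : ℝ)}) atTop (𝓝 1) := by
  have h1 : Tendsto (fun n => 1 - ENNReal.ofReal (b n)) atTop (𝓝 1) := by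
    have := ENNReal.Tendsto.sub (tendsto_const_nhds (x := (1 : ENNReal)) (f := atTop))
      (ENNReal.tendsto_ofReal hb) (Or.inl ENNReal.one_ne_top)
    simpa using this
  refine tendsto_of_tendsto_of_tendsto_of_le_of_le' h1 tendsto_const_nhds ?_ ?_
  · filter_upwards [h, hdm] with n hn hdmn
    have := isProbabilityMeasure_edgeDependentModel (n := n) hdmn
    have hc : {H : Hypergraph n (m n) | f n ≤ (H.disc : ℝ)} = {H | (H.disc : ℝ) < f n}ᶜ := by
      ext H
      simp
    rw [hc, prob_compl_eq_one_sub (Set.toFinite _).measurableSet]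
    exact tsub_le_tsub_left hn 1
  · filter_upwards [hdm] with n hdmn
    have := isProbabilityMeasure_edgeDependentModel (n := n) hdmn
    exact prob_le_one

theorem tendsto_natCast_mul_half_pow (C : ℝ) :
    Tendsto (fun n : ℕ => C * (n * (1 / 2 : ℝ) ^ n)) atTop (𝓝 0) := by
  have := (tendsto_self_mul_const_pow_of_lt_one (r := (1 / 2 : ℝ)) (by norm_num)
    (by norm_num)).const_mul C
  simpa using this

end Discrepancy

end RandomHypergraph

/-! ### Assembly of the limit statements. -/

theorem theorem2 (c : ℝ) (hc : c < 1) :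
    ∃ κ : ℝ, 0 < κ ∧ ∀ m d : ℕ → ℕ,
      Tendsto (fun n : ℕ => (d n : ℝ) * n / m n) atTop atTop →
      Tendsto d atTop atTop →
      (∀ᶠ n : ℕ in atTop, (d n : ℝ) / m n ≤ c) →
      (((fun n : ℕ => (m n : ℝ)) =O[atTop] fun n : ℕ => (n : ℝ)) →
        Tendsto (fun n : ℕ => RandomHypergraph.edgeDependentModel n (m n) (d n)
            {H | κ * max ((2 : ℝ) ^ (-((n : ℝ) / m n)) * Real.sqrt ((d n : ℝ) * n / m n)) 1
              ≤ (H.disc : ℝ)}) atTop (𝓝 1)) ∧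
      (((fun n : ℕ => (n : ℝ)) =o[atTop] fun n : ℕ => (m n : ℝ)) →
        Tendsto (fun n : ℕ => RandomHypergraph.edgeDependentModel n (m n) (d n)
            {H | κ * Real.sqrt ((d n : ℝ) * n / m n *
                Real.log (min ((m n : ℝ) / n) ((d n : ℝ) * n / m n)))
              ≤ (H.disc : ℝ)}) atTop (𝓝 1)) := by
  -- The minimum with `1` covers negative `c`.
  set η := min (1 - c) 1 with hη
  have hη0 : 0 < η := lt_min (by linarith) one_pos
  have hη1 : η ≤ 1 := min_le_right _ _
  have hcη : c ≤ 1 - η := by linarith [min_le_left (1 - c) 1]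
  refine ⟨√η / 1000, by positivity, fun m d hX hd hcd => ?_⟩
  have hdR : Tendsto (fun n => (d n : ℝ)) atTop atTop := tendsto_natCast_atTop_atTop.comp hd
  have ht : Tendsto (fun n => √√(d n : ℝ)) atTop atTop :=
    Real.tendsto_sqrt_atTop.comp (Real.tendsto_sqrt_atTop.comp hdR)
  have ht4 : ∀ n, √√(d n : ℝ) ^ 4 = d n := fun n => by
    calc √√(d n : ℝ) ^ 4 = (√√(d n : ℝ) ^ 2) ^ 2 := by ring
      _ = (d n : ℝ) := by rw [Real.sq_sqrt (Real.sqrt_nonneg _), Real.sq_sqrt (by positivity)]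
  have hbasic : ∀ᶠ n in atTop, 8 / η ≤ √√(d n : ℝ) ∧ 4 ≤ n ∧ d n < m n ∧
      (d n / m n : ℝ) ≤ 1 - η ∧ m n ≤ d n * n := by
    filter_upwards [ht.eventually_ge_atTop (8 / η), eventually_ge_atTop 4, hcd,
      hX.eventually_ge_atTop 1, hd.eventually_ge_atTop 1] with n h1 h2 h3 h4 h5
    -- If `m n = 0`, the quotient `d n * n / m n` is `0` by convention, against its being at least
    -- `1`.
    have hm : (0 : ℝ) < m n := by
      rcases Nat.eq_zero_or_pos (m n) with h | h
      · rw [h] at h4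
        norm_num at h4
      · exact_mod_cast h
    refine ⟨h1, h2, ?_, h3.trans hcη, ?_⟩
    · have h6 : (d n : ℝ) / m n < 1 := h3.trans_lt hc
      rw [div_lt_one hm] at h6
      exact_mod_cast h6
    · rw [le_div_iff₀ hm, one_mul] at h4
      exact_mod_cast h4
  have hdm : ∀ᶠ n in atTop, d n ≤ m n := hbasic.mono fun n h => h.2.2.1.le
  refine ⟨fun _ => ?_, fun hmn => ?_⟩
  · refine RandomHypergraph.tendsto_measure_le_disc hdm
      (b := fun n => 1 / (d n : ℝ) + 4096 / η ^ 4 * (n * (1 / 2) ^ n)) ?_ ?_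
    · have := (tendsto_const_nhds (x := (1 : ℝ))).div_atTop hdR
      simpa using this.add (RandomHypergraph.tendsto_natCast_mul_half_pow (4096 / η ^ 4))
    · filter_upwards [hbasic] with n ⟨h1, h2, h3, h4, h5⟩
      exact RandomHypergraph.edgeDependentModel_disc_lt_max_le hη0 hη1 (ht4 n) h1 h2 h3 h4 h5
  · have hw : Tendsto (fun n => (m n : ℝ) / n) atTop atTop := by
      have h1 := hmn.tendsto_div_nhds_zero
      have h2 : Tendsto (fun n : ℕ => (n : ℝ) / m n) atTop (𝓝[>] 0) := by
        refine tendsto_nhdsWithin_iff.2 ⟨h1, ?_⟩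
        filter_upwards [hbasic] with n ⟨_, h2, h3, _⟩
        have hn : (0 : ℝ) < n := by exact_mod_cast (by omega : 0 < n)
        have hm : (0 : ℝ) < m n := by exact_mod_cast (by omega : 0 < m n)
        exact div_pos hn hm
      refine h2.inv_tendsto_nhdsGT_zero.congr fun n => ?_
      simp
    have hγ : Tendsto (fun n => Real.log (min ((m n : ℝ) / n) (d n * n / m n))) atTop atTop :=
      Real.tendsto_log_atTop.comp <| tendsto_atTop.2 fun b => by
        filter_upwards [hw.eventually_ge_atTop b, hX.eventually_ge_atTop b] with n h1 h2
        exact le_min h1 h2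
    refine RandomHypergraph.tendsto_measure_le_disc hdm
      (b := fun n => Real.exp (-n) + 4096 / η ^ 4 * (n * (1 / 2) ^ n)) ?_ ?_
    · have := Real.tendsto_exp_neg_atTop_nhds_zero.comp (tendsto_natCast_atTop_atTop (R := ℝ))
      simpa using this.add (RandomHypergraph.tendsto_natCast_mul_half_pow (4096 / η ^ 4))
    · filter_upwards [hbasic, hw.eventually_ge_atTop 16, hγ.eventually_ge_atTop 7,
        (Real.tendsto_sqrt_atTop.comp hX).eventually_ge_atTop (8 / η)]
        with n ⟨h1, h2, h3, h4, h5⟩ h6 h7 h8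
      exact RandomHypergraph.edgeDependentModel_disc_lt_sqrt_le hη0 hη1 (ht4 n) h1 h2 h3 h4 h5
        h6 h8 h7
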